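/- All logarithms are to base 2. A finite graph is simple and undirected. A graph $G=(V,E)$ is 2-vertex-connected if it is connected and, for every $u\in V$, the graph $G\setminus\{u\}$ is (nonempty and) connected. It is bridgeless if it is connected and $G\setminus\{e\}$ is connected for every edge $e$. A $(d,c)$-cycle cover of a graph is a finite collection of simple cycles of the graph, each of length at most $d$, such that each edge lies on at least one and at most $c$ of the cycles. A $(d,c)$-private neighborhood trees collection of $G$ is a family of subgraphs $(T(u))_{u\in V}$ of $G$ such that each $T(u)$ is a tree that contains all neighbors of $u$ but does not contain $u$, each $T(u)$ has diameter at most $d$, and each edge of $G$ lies in at most $c$ of the trees. **Theorem.** (1) There is an absolute constant $K$ such that every finite 2-vertex-connected graph $G$ with $n$ vertices, maximum degree $\Delta$ and diameter $D$ has a $(d,c)$-private neighborhood trees collection with $$d = K\cdot D\,\Delta\log n,\qquad c = K\cdot D\,\log\Delta\,\log^3 n .$$ (2) There is an absolute constant $K$ such that the following holds for every finite 2-vertex-connected graph $G$ with $m$ edges, maximum degree $\Delta$ and diameter $D$, and all natural numbers $d,c$. If every bridgeless graph with at most $Km$ vertices and diameter at most $KD$ has a $(d,c)$-cycle cover, then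 $G$ has a $(K d\Delta,\; K c\,d\log\Delta)$-private neighborhood trees collection. -/

import Mathlib

namespace PrivateTrees

/-- A graph is 2-vertex-connected if it is connected and stays connected (in particular nonempty)
after the removal of any single vertex. -/
def IsTwoVertexConnected {V : Type*} (G : SimpleGraph V) : Prop :=
  G.Connected ∧ ∀ u : V, (G.induce {u}ᶜ).Connected

/-- A graph is bridgeless if it is connected and stays connected after the removal of any single
edge. -/
def IsBridgeless {V : Type*} (G : SimpleGraph V) : Prop :=
  G.Connected ∧ ∀ e ∈ G.edgeSet, (G.deleteEdges {e}).Connected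

/-- `G` has a `(d, c)`-cycle cover: a finite collection of (simple) cycles of `G`, each of length at
most `d`, such that each edge of `G` lies on at least one and at most `c` of them. -/
def HasCycleCover {V : Type*} (G : SimpleGraph V) (d c : ℕ) : Prop :=
  ∃ (k : ℕ) (v : Fin k → V) (p : ∀ i, G.Walk (v i) (v i)),
    (∀ i, (p i).IsCycle) ∧
    (∀ i, (p i).length ≤ d) ∧
    ∀ e ∈ G.edgeSet, (∃ i, e ∈ (p i).edges) ∧ {i | e ∈ (p i).edges}.ncard ≤ c

/-- The family of subgraphs `T u` of `G` is a `(d, c)`-private neighborhood trees collection: each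
`T u` is a tree that contains all neighbors of `u` but not `u` itself, has diameter at most `d`, and
each edge of `G` lies in at most `c` of the trees. -/
structure IsPrivateNeighborhoodTrees {V : Type*} (G : SimpleGraph V) (T : V → G.Subgraph)
    (d c : ℝ) : Prop where
  isTree : ∀ u, (T u).coe.IsTree
  neighbors_subset : ∀ u, G.neighborSet u ⊆ (T u).verts
  avoids : ∀ u, u ∉ (T u).verts
  dilation : ∀ u, ((T u).coe.diam : ℝ) ≤ d
  congestion : ∀ e ∈ G.edgeSet, ({u | e ∈ (T u).edgeSet}.ncard : ℝ) ≤ c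

end PrivateTrees

/-! The neighbors of `u` must be joined by few edges avoiding `u`, for all `u` at once and with low
congestion. At each stage the neighbors of `u` fall into classes of vertices already joined. In the
gadget graph every `u` becomes a star with one node per class, and every edge of `G` becomes an edge
between the nodes of the corresponding classes. A covering cycle through the star edge at a non-hub
node, projected to `G` without its edges at `u`, joins the class of that node to a different class
(`exists_merge_of_isCycle`).

One cycle per non-hub node thus halves, for every `u`, the number of classes beyond the first, so
about `log Δ` rounds suffice (`exists_iterated_merging`). Edge counts form a geometric series of sum
at most `2Δd`. Each round adds congestion at most `cd`: an edge lies on at most `c` cycles, and a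
cycle with at most `d` edges contains star edges of at most `d` vertices. A spanning tree of the
resulting component is `T u`. The gadget graph is bridgeless, with at most `2m` nodes and diameter
at most `3D + 2`, which gives the reduction to cycle covers.

For the unconditional bound, bridgeless graphs get covers with length `O(D log m)` and congestion
`O(log² m)` (`IsBridgeless.hasCycleCover`). Averaging over the cycle space covers all edges by
logarithmically many even sets. An even set `Z` is the sum modulo 2 of the closed walks formed by
its edges and the root paths of their ends in a shortest-path tree, since the root paths cancel.
Summing these walks over groups of logarithmic size gives small even sets, which split into cycles.

The congestion on a tree edge is controlled by the groups having an odd number of endpoints below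
it. The vertices below a tree edge form an interval in the lexicographic order of root paths, so few
such groups per lower set suffice. `exists_grouping` achieves this by sorting half-edges,
contracting runs of 16 to vertices, and splitting off short even sets of the resulting multigraph,
which exist by a ball-growing argument. -/

namespace PrivateTrees

open Finset

/-! ### Even edge sets of multigraphs -/

section EvenSets

variable {ι V : Type*}

/-- The sum of `φ` over all endpoints of the edges in `S`, where edge `i` joins `a i` and `b i`. -/
def endpointSum (a b : ι → V) (φ : V → ZMod 2) (S : Finset ι) : ZMod 2 :=
  ∑ i ∈ S, (φ (a i) + φ (b i))

/-- `S` meets every vertex an even number of times; this is expressed by testing against all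
functions on the vertices. -/
def IsEvenSet (a b : ι → V) (S : Finset ι) : Prop :=
  ∀ φ : V → ZMod 2, endpointSum a b φ S = 0

/-- The vertices of `U` that are joined to `v` by a set of at most `r` edges of `F`. -/
noncomputable def edgeBall (a b : ι → V) (U : Finset V) (F : Finset ι) (v : V) (r : ℕ) : Finset V :=
  by
    classical
    exact U.filter fun w => ∃ Q ⊆ F, #Q ≤ r ∧ ∀ φ, endpointSum a b φ Q = φ v + φ w

theorem mem_edgeBall {a b : ι → V} {U : Finset V} {F : Finset ι} {v w : V} {r : ℕ} :
    w ∈ edgeBall a b U F v r ↔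
      w ∈ U ∧ ∃ Q ⊆ F, #Q ≤ r ∧ ∀ φ, endpointSum a b φ Q = φ v + φ w := by
  classical
  simp [edgeBall]

theorem edgeBall_mono_radius (a b : ι → V) (U : Finset V) (F : Finset ι) (v : V) {r s : ℕ}
    (h : r ≤ s) : edgeBall a b U F v r ⊆ edgeBall a b U F v s := by
  intro w hw
  rw [mem_edgeBall] at hw ⊢
  obtain ⟨hU, Q, hQ, hr, hφ⟩ := hw
  exact ⟨hU, Q, hQ, hr.trans h, hφ⟩

theorem self_mem_edgeBall (a b : ι → V) {U : Finset V} (F : Finset ι) {v : V} (hv : v ∈ U)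
    (r : ℕ) : v ∈ edgeBall a b U F v r := by
  rw [mem_edgeBall]
  refine ⟨hv, ∅, by simp, by simp, fun φ => ?_⟩
  rw [CharTwo.add_self_eq_zero]
  simp [endpointSum]

/-- Some ball of logarithmic radius at most doubles when the radius grows by one. -/
theorem exists_edgeBall_card_succ_le (a b : ι → V) {U : Finset V} (F : Finset ι) {v : V}
    (hv : v ∈ U) : ∃ r ≤ Nat.log 2 #U,
      #(edgeBall a b U F v (r + 1)) ≤ 2 * #(edgeBall a b U F v r) := by
  classical
  by_contra! hcon
  have key : ∀ r ≤ Nat.log 2 #U + 1, 2 ^ r ≤ #(edgeBall a b U F v r) := by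
    intro r
    induction r with
    | zero =>
      intro _
      simpa using Finset.card_pos.2 ⟨v, self_mem_edgeBall a b F hv 0⟩
    | succ r ih =>
      intro hr
      have h1 := ih (by omega)
      have h2 := hcon r (by omega)
      rw [pow_succ]
      omega
  have h1 := key _ le_rfl
  have h2 : #(edgeBall a b U F v (Nat.log 2 #U + 1)) ≤ #U := by
    unfold edgeBall
    exact Finset.card_filter_le _ _
  have h3 := Nat.lt_pow_succ_log_self (b := 2) (by norm_num) #U
  omega

variable [DecidableEq ι]

theorem sum_symmDiff_zmod_two (f : ι → ZMod 2) (S T : Finset ι) :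
    ∑ i ∈ symmDiff S T, f i = ∑ i ∈ S, f i + ∑ i ∈ T, f i := by
  have h1 := Finset.sum_sdiff (f := f) (Finset.inter_subset_left (s₁ := S) (s₂ := T))
  have h2 := Finset.sum_sdiff (f := f) (Finset.inter_subset_right (s₁ := S) (s₂ := T))
  rw [Finset.sdiff_inter_self_left] at h1
  rw [Finset.sdiff_inter_self_right] at h2
  have hd : Disjoint (S \ T) (T \ S) := disjoint_sdiff_sdiff
  have h3 : symmDiff S T = (S \ T) ∪ (T \ S) := rfl
  rw [h3, Finset.sum_union hd, ← h1, ← h2]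
  have h4 := CharTwo.add_self_eq_zero (∑ i ∈ S ∩ T, f i)
  linear_combination -h4

theorem card_symmDiff_le (S T : Finset ι) : #(symmDiff S T) ≤ #S + #T :=
  (Finset.card_le_card (symmDiff_le_sup (a := S) (b := T))).trans (Finset.card_union_le S T)

theorem endpointSum_symmDiff (a b : ι → V) (φ : V → ZMod 2) (S T : Finset ι) :
    endpointSum a b φ (symmDiff S T) = endpointSum a b φ S + endpointSum a b φ T :=
  sum_symmDiff_zmod_two _ S T

theorem IsEvenSet.symmDiff {a b : ι → V} {S T : Finset ι} (hS : IsEvenSet a b S)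
    (hT : IsEvenSet a b T) : IsEvenSet a b (symmDiff S T) := fun φ => by
  rw [endpointSum_symmDiff, hS φ, hT φ, add_zero]

theorem IsEvenSet.sdiff {a b : ι → V} {S T : Finset ι} (hS : IsEvenSet a b S)
    (hT : IsEvenSet a b T) (h : T ⊆ S) : IsEvenSet a b (S \ T) := by
  have := hS.symmDiff hT
  rwa [symmDiff_of_ge h] at this

/-- If every edge `f ∈ F` is the symmetric difference of the sets `q` at its endpoints, then there
are at most as many edges as endpoints. -/
theorem card_le_of_symmDiff_eq_singleton [Finite ι] (a b : ι → V) (q : V → Finset ι)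
    (F : Finset ι) (B : Finset V) (ha : ∀ f ∈ F, a f ∈ B) (hb : ∀ f ∈ F, b f ∈ B)
    (h : ∀ f ∈ F, symmDiff (q (a f)) (q (b f)) = {f}) : #F ≤ #B := by
  classical
  have := Fintype.ofFinite ι
  let ind : Finset ι → ι → ZMod 2 := fun S i => if i ∈ S then 1 else 0
  have hind : ∀ S T, ind (symmDiff S T) = ind S + ind T := by
    intro S T
    ext i
    have := sum_symmDiff_zmod_two (fun j => if j = i then 1 else 0) S T
    simpa [ind, Finset.sum_ite_eq'] using this
  let w : Finset (ι → ZMod 2) := B.image (fun x => ind (q x))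
  -- Over `ZMod 2`, the unit vectors of the edges in `F` are independent and lie in the span of the
  -- indicators of `q x` for `x ∈ B`.
  have hli : LinearIndependent (ZMod 2) (fun f : F => (Pi.single (f : ι) 1 : ι → ZMod 2)) :=
    (Pi.linearIndependent_single_one ι (ZMod 2)).comp (fun f : F => (f : ι))
      Subtype.val_injective
  have hmem : ∀ f : F, (Pi.single (f : ι) 1 : ι → ZMod 2) ∈
      Submodule.span (ZMod 2) (w : Set (ι → ZMod 2)) := by
    rintro ⟨f, hf⟩
    have e : (Pi.single f 1 : ι → ZMod 2) = ind (q (a f)) + ind (q (b f)) := by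
      rw [← hind, h f hf]
      ext i
      simp [ind, Pi.single_apply]
    simp only [e]
    refine Submodule.add_mem _ (Submodule.subset_span ?_) (Submodule.subset_span ?_)
    · exact Finset.mem_coe.2 (Finset.mem_image_of_mem _ (ha f hf))
    · exact Finset.mem_coe.2 (Finset.mem_image_of_mem _ (hb f hf))
  have hli' : LinearIndependent (ZMod 2) (fun f : F => (⟨_, hmem f⟩ :
      Submodule.span (ZMod 2) (w : Set (ι → ZMod 2)))) :=
    LinearIndependent.of_comp (Submodule.subtype _) hli
  have h1 := hli'.fintype_card_le_finrank
  have h2 := finrank_span_finset_le_card (R := ZMod 2) w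
  rw [Fintype.card_coe] at h1
  exact h1.trans (h2.trans Finset.card_image_le)

theorem mem_edgeBall_succ {a b : ι → V} {U : Finset V} {F : Finset ι} {v x y : V} {r : ℕ}
    (hx : x ∈ edgeBall a b U F v r) (hy : y ∈ U) {f : ι} (hf : f ∈ F)
    (h : ∀ φ : V → ZMod 2, φ (a f) + φ (b f) = φ x + φ y) :
    y ∈ edgeBall a b U F v (r + 1) := by
  rw [mem_edgeBall] at hx ⊢
  obtain ⟨-, Q, hQ, hr, hφ⟩ := hx
  refine ⟨hy, symmDiff Q {f}, ?_, ?_, fun φ => ?_⟩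
  · exact (symmDiff_le_sup (a := Q) (b := {f})).trans
      (Finset.union_subset hQ (Finset.singleton_subset_iff.2 hf))
  · refine (card_symmDiff_le Q {f}).trans ?_
    simpa using hr
  · rw [endpointSum_symmDiff, hφ]
    have : endpointSum a b φ {f} = φ x + φ y := by simp [endpointSum, h φ]
    rw [this]
    have h4 := CharTwo.add_self_eq_zero (φ x)
    linear_combination h4

/-- A multigraph with more than twice as many edges as vertices has a nonempty even edge set of
logarithmic size. -/
theorem exists_small_isEvenSet [Finite ι] (a b : ι → V) (U : Finset V) (F : Finset ι)
    (ha : ∀ f ∈ F, a f ∈ U) (hb : ∀ f ∈ F, b f ∈ U) (hcard : 2 * #U < #F) :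
    ∃ S ⊆ F, S.Nonempty ∧ #S ≤ 2 * Nat.log 2 #U + 3 ∧ IsEvenSet a b S := by
  classical
  induction hn : #U using Nat.strong_induction_on generalizing U F with
  | _ n ih =>
  subst hn
  obtain ⟨f₀, hf₀⟩ : F.Nonempty := Finset.card_pos.1 (by omega)
  set v := a f₀
  have hv : v ∈ U := ha _ hf₀
  obtain ⟨r, hr, hball⟩ := exists_edgeBall_card_succ_le a b F hv
  set B := edgeBall a b U F v r with hB
  set B' := edgeBall a b U F v (r + 1) with hB'
  have hBU : B ⊆ U := fun w hw => (mem_edgeBall.1 hw).1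
  have hvB : v ∈ B := self_mem_edgeBall a b F hv r
  -- All edges touching the ball have both ends in the next ball, which is at most twice as large.
  -- Removing `B` and `F₁` keeps the density hypothesis provided `#F₁ ≤ #B'`.
  set F₁ := F.filter fun f => a f ∈ B ∨ b f ∈ B with hF₁
  have hends : ∀ f ∈ F₁, a f ∈ B' ∧ b f ∈ B' := by
    intro f hf
    obtain ⟨hfF, h⟩ := Finset.mem_filter.1 hf
    rcases h with h | h
    · exact ⟨edgeBall_mono_radius a b U F v (Nat.le_succ r) h,
        mem_edgeBall_succ h (hb f hfF) hfF fun φ => rfl⟩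
    · exact ⟨mem_edgeBall_succ h (ha f hfF) hfF fun φ => add_comm _ _,
        edgeBall_mono_radius a b U F v (Nat.le_succ r) h⟩
  -- The empty set serves outside `B'` only to make the choice of `q` total.
  have hq : ∀ x, ∃ Q ⊆ F, x ∈ B' → #Q ≤ r + 1 ∧ ∀ φ, endpointSum a b φ Q = φ v + φ x := by
    intro x
    by_cases hx : x ∈ B'
    · obtain ⟨-, Q, hQ, h1, h2⟩ := mem_edgeBall.1 hx
      exact ⟨Q, hQ, fun _ => ⟨h1, h2⟩⟩
    · exact ⟨∅, by simp, fun h => absurd h hx⟩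
  choose q hqF hq using hq
  -- Each `f ∈ F₁` closes up with the two sets joining `v` to its ends, giving an even set of at
  -- most `2(r + 1) + 1` edges. Either all of these are empty and the rank bound permits induction,
  -- or a nonempty one is the desired set.
  by_cases hz : ∀ f ∈ F₁, symmDiff (q (a f)) (q (b f)) = {f}
  · have h1 : #F₁ ≤ #B' := card_le_of_symmDiff_eq_singleton a b q F₁ B'
      (fun f hf => (hends f hf).1) (fun f hf => (hends f hf).2) hz
    have h2 : #(F \ F₁) = #F - #F₁ := Finset.card_sdiff_of_subset (Finset.filter_subset _ _)
    have h3 : #(U \ B) = #U - #B := Finset.card_sdiff_of_subset hBU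
    have h4 : 0 < #B := Finset.card_pos.2 ⟨v, hvB⟩
    have h5 := Finset.card_le_card hBU
    have hout : ∀ f ∈ F \ F₁, a f ∈ U \ B ∧ b f ∈ U \ B := by
      intro f hf
      obtain ⟨hfF, hf1⟩ := Finset.mem_sdiff.1 hf
      have : ¬ (a f ∈ B ∨ b f ∈ B) := fun h => hf1 (Finset.mem_filter.2 ⟨hfF, h⟩)
      push Not at this
      exact ⟨Finset.mem_sdiff.2 ⟨ha f hfF, this.1⟩, Finset.mem_sdiff.2 ⟨hb f hfF, this.2⟩⟩
    obtain ⟨S, hS, hne, hle, hev⟩ := ih #(U \ B) (by omega) (U \ B) (F \ F₁)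
      (fun f hf => (hout f hf).1) (fun f hf => (hout f hf).2) (by omega) rfl
    refine ⟨S, hS.trans Finset.sdiff_subset, hne, hle.trans ?_, hev⟩
    have := Nat.log_mono_right (b := 2) (show #(U \ B) ≤ #U by omega)
    omega
  · push Not at hz
    obtain ⟨f, hf, hne⟩ := hz
    have hfF : f ∈ F := (Finset.mem_filter.1 hf).1
    obtain ⟨hfa, hfb⟩ := hends f hf
    refine ⟨symmDiff (symmDiff (q (a f)) (q (b f))) {f}, ?_, ?_, ?_, fun φ => ?_⟩
    · refine (symmDiff_le_sup (a := symmDiff (q (a f)) (q (b f))) (b := {f})).trans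
        (Finset.union_subset ?_ (Finset.singleton_subset_iff.2 hfF))
      exact (symmDiff_le_sup (a := q (a f)) (b := q (b f))).trans
        (Finset.union_subset (hqF _) (hqF _))
    · rw [Finset.nonempty_iff_ne_empty]
      intro h
      exact hne (symmDiff_eq_bot.1 h)
    · have h1 := card_symmDiff_le (symmDiff (q (a f)) (q (b f))) {f}
      have h2 := card_symmDiff_le (q (a f)) (q (b f))
      have h3 := (hq _ hfa).1
      have h4 := (hq _ hfb).1
      rw [Finset.card_singleton] at h1
      omega
    · rw [endpointSum_symmDiff, endpointSum_symmDiff, (hq _ hfa).2, (hq _ hfb).2]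
      simp only [endpointSum, Finset.sum_singleton]
      have h4 := CharTwo.add_self_eq_zero (φ v)
      have h5 := CharTwo.add_self_eq_zero (φ (a f))
      have h6 := CharTwo.add_self_eq_zero (φ (b f))
      linear_combination h4 + h5 + h6

/-- Disjoint small even sets can be split off until at most `2 * #U` edges are left. -/
theorem exists_disjoint_small_isEvenSet [Finite ι] (a b : ι → V) (U : Finset V) (F : Finset ι)
    (ha : ∀ f ∈ F, a f ∈ U) (hb : ∀ f ∈ F, b f ∈ U) :
    ∃ P : Finset (Finset ι), (P : Set (Finset ι)).PairwiseDisjoint id ∧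
      (∀ S ∈ P, S ⊆ F ∧ #S ≤ 2 * Nat.log 2 #U + 3 ∧ IsEvenSet a b S) ∧
      #(F \ P.biUnion id) ≤ 2 * #U := by
  classical
  induction hn : #F using Nat.strong_induction_on generalizing F with
  | _ n ih =>
  subst hn
  by_cases hle : #F ≤ 2 * #U
  · exact ⟨∅, by simp, by simp, by simpa using hle⟩
  · obtain ⟨S, hSF, hne, hcard, hev⟩ := exists_small_isEvenSet a b U F ha hb (by omega)
    have hlt : #(F \ S) < #F := Finset.card_lt_card (Finset.sdiff_ssubset hSF hne)
    obtain ⟨P, hP, hPS, hleft⟩ := ih _ hlt (F \ S)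
      (fun f hf => ha f (Finset.mem_sdiff.1 hf).1) (fun f hf => hb f (Finset.mem_sdiff.1 hf).1) rfl
    refine ⟨insert S P, ?_, ?_, ?_⟩
    · rw [Finset.coe_insert]
      refine hP.insert fun T hT _ => ?_
      exact (Finset.disjoint_of_subset_left (hPS T hT).1 Finset.sdiff_disjoint).symm
    · intro T hT
      rcases Finset.mem_insert.1 hT with rfl | hT
      · exact ⟨hSF, hcard, hev⟩
      · exact ⟨(hPS T hT).1.trans Finset.sdiff_subset, (hPS T hT).2⟩
    · rw [Finset.biUnion_insert, id, ← Finset.sup_eq_union, ← sdiff_sdiff_left]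
      exact hleft

end EvenSets

/-! ### Grouping edges with low discrepancy on lower sets -/

section Grouping

/-- Sorting gives distinct ranks even when positions coincide; equal positions are ordered
arbitrarily. -/
theorem exists_injOn_rank {δ α : Type*} [LinearOrder α] (D : Finset δ) (pos : δ → α) :
    ∃ ρ : δ → ℕ, Set.InjOn ρ D ∧ (∀ d ∈ D, ρ d < #D) ∧
      ∀ d ∈ D, ∀ d' ∈ D, ρ d ≤ ρ d' → pos d ≤ pos d' := by
  classical
  let g : Fin #D → α := fun i => pos (D.equivFin.symm i)
  let σ := Tuple.sort g
  refine ⟨fun d => if h : d ∈ D then (σ.symm (D.equivFin ⟨d, h⟩) : ℕ) else 0, ?_, ?_, ?_⟩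
  · intro d hd d' hd' h
    have hd : d ∈ D := hd
    have hd' : d' ∈ D := hd'
    simp only [hd, hd', dif_pos] at h
    have := D.equivFin.injective (σ.symm.injective (Fin.ext h))
    exact congrArg Subtype.val this
  · intro d hd
    simp only [hd, dif_pos]
    exact Fin.is_lt _
  · intro d hd d' hd' h
    simp only [hd, hd', dif_pos] at h
    have := Tuple.monotone_sort g (Fin.le_def.2 h)
    simpa [σ, g] using this

theorem card_filter_div_eq_le {δ : Type*} (D : Finset δ) (ρ : δ → ℕ) (hρ : Set.InjOn ρ D)
    (k j : ℕ) (hk : 0 < k) : #(D.filter fun d => ρ d / k = j) ≤ k := by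
  classical
  have h : #(D.filter fun d => ρ d / k = j) ≤ #(Finset.Ico (k * j) (k * j + k)) := by
    refine Finset.card_le_card_of_injOn ρ ?_ ?_
    · intro d hd
      have hd : d ∈ D.filter fun d => ρ d / k = j := hd
      have h := (Finset.mem_filter.1 hd).2
      have h1 := Nat.div_add_mod (ρ d) k
      have h2 := Nat.mod_lt (ρ d) hk
      rw [h] at h1
      rw [Finset.coe_Ico, Set.mem_Ico]
      omega
    · exact hρ.mono fun d hd => (Finset.mem_filter.1 hd).1
  simpa using h

variable {ι α : Type*} [DecidableEq ι] [Finite ι] [LinearOrder α]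

/-- At least half of the edges can be covered by disjoint groups of logarithmic size such that each
lower set contains an odd number of endpoints of only boundedly many groups. -/
theorem exists_grouping_half (a b : ι → α) (F : Finset ι) (hF : 8 ≤ #F) :
    ∃ P : Finset (Finset ι), (P : Set (Finset ι)).PairwiseDisjoint id ∧
      (∀ S ∈ P, S ⊆ F ∧ #S ≤ 2 * Nat.log 2 #F + 3) ∧
      (∀ L : Set α, IsLowerSet L →
        #(P.filter fun S => endpointSum a b (L.indicator 1) S ≠ 0) ≤ 16) ∧
      #(F \ P.biUnion id) ≤ #F / 2 := by
  classical
  -- `D` consists of the half-edges of `F`, placed at the positions of their ends.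
  set D : Finset (ι × Bool) := F ×ˢ Finset.univ with hD
  have hDcard : #D = 2 * #F := by simp [hD, mul_comm]
  let pos : ι × Bool → α := fun d => if d.2 then b d.1 else a d.1
  obtain ⟨ρ, hinj, hlt, hmono⟩ := exists_injOn_rank D pos
  have hmem : ∀ f ∈ F, ∀ s, (f, s) ∈ D := fun f hf s => by simp [hD, hf]
  -- The `2 * #F` half-edges are cut into buckets of 16 consecutive ranks, which become vertices.
  -- Twice their number is at most `#F / 2` because `8 ≤ #F`.
  set U := Finset.range (#F / 8 + 1) with hU
  have hUcard : #U = #F / 8 + 1 := by simp [hU]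
  have hends : ∀ f ∈ F, ∀ s, ρ (f, s) / 16 ∈ U := by
    intro f hf s
    have := hlt _ (hmem f hf s)
    rw [hU, Finset.mem_range]
    omega
  obtain ⟨P, hdisj, hP, hleft⟩ := exists_disjoint_small_isEvenSet
    (fun f => ρ (f, false) / 16) (fun f => ρ (f, true) / 16) U F
    (fun f hf => hends f hf _) (fun f hf => hends f hf _)
  refine ⟨P, hdisj, fun S hS => ⟨(hP S hS).1, ?_⟩, fun L hL => ?_, by omega⟩
  · have := Nat.log_mono_right (b := 2) (show #U ≤ #F by omega)
    have := (hP S hS).2.1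
    omega
  -- A lower set is the initial segment of ranks below `t`, so only bucket `t / 16` can be mixed. A
  -- group with no half-edge there has as many ends in `L` as in the buckets before `t / 16`, an
  -- even number. The groups are disjoint, so at most 16 of them meet the mixed bucket.
  · set t := (D.filter fun d => pos d ∈ L).sup fun d => ρ d + 1 with ht
    have hLt : ∀ d ∈ D, pos d ∈ L ↔ ρ d < t := by
      intro d hd
      rw [ht, Finset.lt_sup_iff]
      constructor
      · intro h
        exact ⟨d, Finset.mem_filter.2 ⟨hd, h⟩, Nat.lt_succ_self _⟩
      · rintro ⟨d', hd', h⟩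
        obtain ⟨hd'D, hd'L⟩ := Finset.mem_filter.1 hd'
        exact hL (hmono d hd d' hd'D (Nat.lt_succ_iff.1 h)) hd'L
    refine le_trans ?_ (card_filter_div_eq_le D ρ hinj 16 (t / 16) (by norm_num))
    refine Finset.card_le_card_of_forall_subsingleton (fun S d => d.1 ∈ S) ?_ ?_
    · intro S hS
      obtain ⟨hSP, hodd⟩ := Finset.mem_filter.1 hS
      by_contra! hcon
      apply hodd
      rw [← (hP S hSP).2.2 ((Set.Iio (t / 16)).indicator 1)]
      have key : ∀ f ∈ S, ∀ s, L.indicator (1 : α → ZMod 2) (pos (f, s)) =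
          (Set.Iio (t / 16)).indicator (1 : ℕ → ZMod 2) (ρ (f, s) / 16) := by
        intro f hf s
        have hfD := hmem f ((hP S hSP).1 hf) s
        have hne : ρ (f, s) / 16 ≠ t / 16 := fun h =>
          hcon (f, s) (Finset.mem_filter.2 ⟨hfD, h⟩) hf
        have hiff : pos (f, s) ∈ L ↔ ρ (f, s) / 16 ∈ Set.Iio (t / 16) := by
          rw [hLt _ hfD, Set.mem_Iio]
          omega
        by_cases h : pos (f, s) ∈ L
        · rw [Set.indicator_of_mem h, Set.indicator_of_mem (hiff.1 h)]
          rfl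
        · rw [Set.indicator_of_notMem h, Set.indicator_of_notMem (mt hiff.2 h)]
      refine Finset.sum_congr rfl fun f hf => ?_
      rw [← key f hf, ← key f hf]
      simp [pos]
    · rintro d - S ⟨hS, hdS⟩ T ⟨hT, hdT⟩
      have hS := (Finset.mem_filter.1 hS).1
      have hT := (Finset.mem_filter.1 hT).1
      by_contra hne
      exact Finset.disjoint_left.1 (hdisj hS hT hne) hdS hdT

/-- Every edge set can be partitioned into groups of logarithmic size such that each lower set
contains an odd number of endpoints of only logarithmically many groups. -/
theorem exists_grouping (a b : ι → α) (F : Finset ι) :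
    ∃ P : Finset (Finset ι), (P : Set (Finset ι)).PairwiseDisjoint id ∧ P.biUnion id = F ∧
      (∀ S ∈ P, #S ≤ 2 * Nat.log 2 #F + 3) ∧
      (∀ L : Set α, IsLowerSet L →
        #(P.filter fun S => endpointSum a b (L.indicator 1) S ≠ 0) ≤ 16 * Nat.log 2 #F + 8) := by
  classical
  induction hn : #F using Nat.strong_induction_on generalizing F with
  | _ n ih =>
  subst hn
  by_cases hF : #F < 8
  · refine ⟨F.image fun f => {f}, ?_, ?_, ?_, ?_⟩
    · intro S hS T hT hne
      obtain ⟨f, -, rfl⟩ := Finset.mem_image.1 (Finset.mem_coe.1 hS)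
      obtain ⟨g, -, rfl⟩ := Finset.mem_image.1 (Finset.mem_coe.1 hT)
      simpa [Function.onFun] using hne
    · ext f
      simp
    · intro S hS
      obtain ⟨f, -, rfl⟩ := Finset.mem_image.1 hS
      simp
    · intro L _
      have h1 : #((F.image fun f => ({f} : Finset ι)).filter
          fun S => endpointSum a b (L.indicator 1) S ≠ 0) ≤ #F :=
        (Finset.card_filter_le _ _).trans Finset.card_image_le
      omega
  · push Not at hF
    obtain ⟨P, hPd, hPS, hPL, hleft⟩ := exists_grouping_half a b F hF
    set F' := F \ P.biUnion id with hF'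
    obtain ⟨P', hP'd, hP'u, hP'S, hP'L⟩ := ih #F' (by omega) F' rfl
    -- Halving lowers the logarithm by one, which pays for the 16 exceptional groups of this round.
    have hlog : Nat.log 2 #F' + 1 ≤ Nat.log 2 #F := by
      rw [Nat.log_of_one_lt_of_le (b := 2) (n := #F) (by norm_num) (by omega)]
      exact Nat.add_le_add_right (Nat.log_mono_right hleft) 1
    have hdd : ∀ S ∈ P, ∀ T ∈ P', Disjoint S T := by
      intro S hS T hT
      have h1 : S ⊆ P.biUnion id := Finset.subset_biUnion_of_mem id hS
      have h2 : T ⊆ F' := hP'u ▸ Finset.subset_biUnion_of_mem id hT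
      exact Finset.disjoint_of_subset_left h1
        (Finset.disjoint_of_subset_right h2 Finset.disjoint_sdiff)
    refine ⟨P ∪ P', ?_, ?_, ?_, ?_⟩
    · rw [Finset.coe_union]
      refine hPd.union hP'd fun S hS T hT _ => hdd S hS T hT
    · rw [Finset.union_biUnion, hP'u, hF']
      exact Finset.union_sdiff_of_subset (Finset.biUnion_subset.2 fun S hS => (hPS S hS).1)
    · intro S hS
      rcases Finset.mem_union.1 hS with hS | hS
      · exact (hPS S hS).2
      · have := hP'S S hS
        omega
    · intro L hL
      rw [Finset.filter_union]
      have h1 := Finset.card_union_le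
        (P.filter fun S => endpointSum a b (L.indicator 1) S ≠ 0)
        (P'.filter fun S => endpointSum a b (L.indicator 1) S ≠ 0)
      have h2 := hPL L hL
      have h3 := hP'L L hL
      omega

end Grouping

/-! ### Even edge sets of simple graphs -/

section EvenEdges

variable {V : Type*}

/-- A chosen endpoint of an edge. -/
noncomputable def fstEnd (e : Sym2 V) : V := (Quot.out e).1

/-- The endpoint of an edge other than the chosen one. -/
noncomputable def sndEnd (e : Sym2 V) : V := (Quot.out e).2

theorem mk_fstEnd_sndEnd (e : Sym2 V) : s(fstEnd e, sndEnd e) = e := Quot.out_eq e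

/-- The sum is symmetric, so the arbitrary orientation of an edge does not matter. -/
theorem add_ends {M : Type*} [AddCommMonoid M] (φ : V → M) (x y : V) :
    φ (fstEnd s(x, y)) + φ (sndEnd s(x, y)) = φ x + φ y := by
  rcases Sym2.eq_iff.1 (mk_fstEnd_sndEnd s(x, y)) with ⟨h1, h2⟩ | ⟨h1, h2⟩
  · rw [h1, h2]
  · rw [h1, h2, add_comm]

/-- The edge set `C` meets every vertex an even number of times. -/
def IsEvenEdges (C : Finset (Sym2 V)) : Prop := IsEvenSet fstEnd sndEnd C

/-- `S` is the edge set of a simple cycle of `G`. -/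
def IsCycleEdges (G : SimpleGraph V) (S : Finset (Sym2 V)) : Prop :=
  ∃ (v : V) (p : G.Walk v v), p.IsCycle ∧ ∀ e, e ∈ S ↔ e ∈ p.edges

/-- Telescoping modulo 2: every inner vertex is counted twice. -/
theorem sum_ends_walk {G : SimpleGraph V} (φ : V → ZMod 2) {u v : V} (p : G.Walk u v) :
    (p.edges.map fun e => φ (fstEnd e) + φ (sndEnd e)).sum = φ u + φ v := by
  induction p with
  | nil => simp [CharTwo.add_self_eq_zero]
  | @cons u w v h p ih =>
    rw [SimpleGraph.Walk.edges_cons, List.map_cons, List.sum_cons, ih, add_ends]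
    have := CharTwo.add_self_eq_zero (φ w)
    linear_combination this

theorem IsCycleEdges.isEvenEdges {G : SimpleGraph V} {S : Finset (Sym2 V)}
    (h : IsCycleEdges G S) : IsEvenEdges S := by
  classical
  obtain ⟨v, p, hp, hS⟩ := h
  have hS' : S = p.edges.toFinset := by
    ext e
    simp [hS]
  intro φ
  rw [endpointSum, hS', List.sum_toFinset _ hp.isCircuit.isTrail.edges_nodup, sum_ends_walk,
    CharTwo.add_self_eq_zero]

theorem IsCycleEdges.subset_edgeSet {G : SimpleGraph V} {S : Finset (Sym2 V)}
    (h : IsCycleEdges G S) : (S : Set (Sym2 V)) ⊆ G.edgeSet := by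
  obtain ⟨v, p, hp, hS⟩ := h
  exact fun e he => p.edges_subset_edgeSet ((hS e).1 he)

theorem IsCycleEdges.nonempty {G : SimpleGraph V} {S : Finset (Sym2 V)}
    (h : IsCycleEdges G S) : S.Nonempty := by
  obtain ⟨v, p, hp, hS⟩ := h
  cases p with
  | nil => exact absurd rfl hp.ne_nil
  | cons h p => exact ⟨_, (hS _).2 List.mem_cons_self⟩

/-- Every edge of an even edge set lies on a cycle inside the set. -/
theorem IsEvenEdges.exists_cycle {G : SimpleGraph V} {C : Finset (Sym2 V)} (hC : IsEvenEdges C)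
    (hG : (C : Set (Sym2 V)) ⊆ G.edgeSet) {e : Sym2 V} (he : e ∈ C) :
    ∃ S ⊆ C, e ∈ S ∧ IsCycleEdges G S := by
  classical
  induction e using Sym2.ind with
  | _ x y =>
  set H := SimpleGraph.fromEdgeSet (C : Set (Sym2 V)) with hH
  have hHG : H ≤ G := by
    intro u v h
    exact hG ((SimpleGraph.fromEdgeSet_adj _).1 h).1
  have hadj : H.Adj x y := by
    rw [hH, SimpleGraph.fromEdgeSet_adj]
    exact ⟨he, (SimpleGraph.mem_edgeSet G).1 (hG he) |>.ne⟩
  have hreach : (H.deleteEdges {s(x, y)}).Reachable x y := by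
    by_contra hcon
    -- If the edge were a bridge of `C`, it would be the only edge of `C` leaving the side `X`, and
    -- testing evenness against the indicator of `X` would give 1.
    set X : Set V := {z | (H.deleteEdges {s(x, y)}).Reachable x z} with hX
    have hx : x ∈ X := SimpleGraph.Reachable.refl x
    have hy : y ∉ X := hcon
    have h0 := hC (X.indicator 1)
    rw [endpointSum, ← Finset.add_sum_erase C _ he, add_ends, Finset.sum_eq_zero,
      Set.indicator_of_mem hx, Set.indicator_of_notMem hy] at h0
    · simp at h0
    · intro f hf
      obtain ⟨hne, hfC⟩ := Finset.mem_erase.1 hf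
      induction f using Sym2.ind with
      | _ u v =>
      rw [add_ends]
      have huv : (H.deleteEdges {s(x, y)}).Adj u v := by
        rw [SimpleGraph.deleteEdges_adj, hH, SimpleGraph.fromEdgeSet_adj]
        exact ⟨⟨hfC, (SimpleGraph.mem_edgeSet G).1 (hG hfC) |>.ne⟩, hne⟩
      have hiff : u ∈ X ↔ v ∈ X :=
        ⟨fun h => h.trans huv.reachable, fun h => h.trans huv.symm.reachable⟩
      by_cases hu : u ∈ X
      · rw [Set.indicator_of_mem hu, Set.indicator_of_mem (hiff.1 hu)]
        exact CharTwo.add_self_eq_zero _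
      · rw [Set.indicator_of_notMem hu, Set.indicator_of_notMem (mt hiff.2 hu), add_zero]
  obtain ⟨u, p, hp, hmem⟩ :=
    SimpleGraph.adj_and_reachable_delete_edges_iff_exists_cycle.1 ⟨hadj, hreach⟩
  refine ⟨p.edges.toFinset, ?_, by simpa using hmem, u, p.mapLe hHG, hp.mapLe hHG, ?_⟩
  · intro f hf
    have h1 := p.edges_subset_edgeSet (List.mem_toFinset.1 hf)
    rw [hH, SimpleGraph.edgeSet_fromEdgeSet] at h1
    exact h1.1
  · intro f
    rw [SimpleGraph.Walk.edges_mapLe_eq_edges, List.mem_toFinset]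

/-- An even edge set is a disjoint union of cycles. -/
theorem IsEvenEdges.exists_cycle_partition [DecidableEq V] {G : SimpleGraph V}
    {C : Finset (Sym2 V)} (hC : IsEvenEdges C) (hG : (C : Set (Sym2 V)) ⊆ G.edgeSet) :
    ∃ P : Finset (Finset (Sym2 V)), (P : Set (Finset (Sym2 V))).PairwiseDisjoint id ∧
      P.biUnion id = C ∧ ∀ S ∈ P, IsCycleEdges G S := by
  induction hn : #C using Nat.strong_induction_on generalizing C with
  | _ n ih =>
  subst hn
  rcases C.eq_empty_or_nonempty with rfl | ⟨e, he⟩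
  · exact ⟨∅, by simp, by simp, by simp⟩
  · obtain ⟨S, hSC, -, hS⟩ := hC.exists_cycle hG he
    have hlt : #(C \ S) < #C := Finset.card_lt_card (Finset.sdiff_ssubset hSC hS.nonempty)
    obtain ⟨P, hd, hu, hP⟩ := ih _ hlt (IsEvenSet.sdiff hC hS.isEvenEdges hSC)
      (fun f hf => hG (Finset.mem_sdiff.1 (Finset.mem_coe.1 hf)).1) rfl
    refine ⟨insert S P, ?_, ?_, ?_⟩
    · rw [Finset.coe_insert]
      refine hd.insert fun T hT _ => ?_
      have hTC : T ⊆ C \ S := hu ▸ Finset.subset_biUnion_of_mem id hT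
      exact (Finset.disjoint_of_subset_left hTC Finset.sdiff_disjoint).symm
    · rw [Finset.biUnion_insert, hu, id]
      exact Finset.union_sdiff_of_subset hSC
    · intro T hT
      rcases Finset.mem_insert.1 hT with rfl | hT
      · exact hS
      · exact hP T hT

end EvenEdges

/-! ### Covering the edges of a bridgeless graph by few even edge sets -/

section Averaging

variable {V : Type*} [DecidableEq V]

theorem IsBridgeless.exists_cycleEdges {G : SimpleGraph V} (hG : IsBridgeless G) {e : Sym2 V}
    (he : e ∈ G.edgeSet) : ∃ S : Finset (Sym2 V), e ∈ S ∧ IsCycleEdges G S := by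
  have hr := hG.2 e he
  induction e using Sym2.ind with
  | _ x y =>
  obtain ⟨u, p, hp, hmem⟩ :=
    SimpleGraph.adj_and_reachable_delete_edges_iff_exists_cycle.1 ⟨he, hr.preconnected x y⟩
  exact ⟨p.edges.toFinset, by simpa using hmem, u, p, hp, by simp⟩

variable [Fintype V]

/-- Some even edge set contains at least half of a given set of edges. -/
theorem IsBridgeless.exists_isEvenEdges_half {G : SimpleGraph V} (hG : IsBridgeless G)
    (A : Finset (Sym2 V)) (hA : (A : Set (Sym2 V)) ⊆ G.edgeSet) :
    ∃ Z : Finset (Sym2 V), IsEvenEdges Z ∧ (Z : Set (Sym2 V)) ⊆ G.edgeSet ∧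
      #(A \ Z) ≤ #A / 2 := by
  classical
  let Zs : Finset (Finset (Sym2 V)) :=
    Finset.univ.filter fun Z => IsEvenEdges Z ∧ (Z : Set (Sym2 V)) ⊆ G.edgeSet
  have hne : Zs.Nonempty := ⟨∅, Finset.mem_filter.2
    ⟨Finset.mem_univ _, fun φ => Finset.sum_empty, by simp⟩⟩
  -- Adding a fixed cycle through `e` maps the even sets missing `e` injectively to those containing
  -- `e`. Hence an average even set contains at least half of `A`.
  have hpt : ∀ e ∈ A, #(Zs.filter fun Z => e ∉ Z) ≤ #(Zs.filter fun Z => e ∈ Z) := by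
    intro e he
    obtain ⟨S, heS, hS⟩ := hG.exists_cycleEdges (hA he)
    refine Finset.card_le_card_of_injOn (fun Z => symmDiff Z S) ?_ ?_
    · intro Z hZ
      have hZ : Z ∈ Zs.filter fun Z => e ∉ Z := hZ
      obtain ⟨hZs, heZ⟩ := Finset.mem_filter.1 hZ
      obtain ⟨-, hev, hsub⟩ := Finset.mem_filter.1 hZs
      refine Finset.mem_coe.2 (Finset.mem_filter.2 ⟨Finset.mem_filter.2 ⟨Finset.mem_univ _,
        IsEvenSet.symmDiff hev hS.isEvenEdges, ?_⟩, ?_⟩)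
      · intro f hf
        rcases Finset.mem_symmDiff.1 (Finset.mem_coe.1 hf) with h | h
        · exact hsub h.1
        · exact hS.subset_edgeSet h.1
      · exact Finset.mem_symmDiff.2 (Or.inr ⟨heS, heZ⟩)
    · intro Z _ Z' _ h
      exact symmDiff_left_injective S h
  have hsum : ∑ Z ∈ Zs, #(A.filter fun e => e ∉ Z) ≤ ∑ Z ∈ Zs, #(A.filter fun e => e ∈ Z) := by
    have h1 := Finset.sum_card_bipartiteAbove_eq_sum_card_bipartiteBelow
      (s := Zs) (t := A) (fun Z e => e ∉ Z)
    have h2 := Finset.sum_card_bipartiteAbove_eq_sum_card_bipartiteBelow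
      (s := Zs) (t := A) (fun Z e => e ∈ Z)
    simp only [Finset.bipartiteAbove, Finset.bipartiteBelow] at h1 h2
    rw [h1, h2]
    exact Finset.sum_le_sum hpt
  obtain ⟨Z, hZ, hle⟩ := Finset.exists_le_of_sum_le hne hsum
  obtain ⟨-, hev, hsub⟩ := Finset.mem_filter.1 hZ
  refine ⟨Z, hev, hsub, ?_⟩
  have h3 := Finset.card_filter_add_card_filter_not (s := A) (fun e => e ∈ Z)
  rw [Finset.sdiff_eq_filter]
  omega

/-- Repeated halving: the part of `A` left uncovered is empty after at most `Nat.log 2 #A + 1` even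
sets. -/
theorem IsBridgeless.exists_isEvenEdges_cover {G : SimpleGraph V} (hG : IsBridgeless G)
    (A : Finset (Sym2 V)) (hA : (A : Set (Sym2 V)) ⊆ G.edgeSet) :
    ∃ Q : Finset (Finset (Sym2 V)), #Q ≤ Nat.log 2 #A + 1 ∧
      (∀ Z ∈ Q, IsEvenEdges Z ∧ (Z : Set (Sym2 V)) ⊆ G.edgeSet) ∧ ∀ e ∈ A, ∃ Z ∈ Q, e ∈ Z := by
  induction hn : #A using Nat.strong_induction_on generalizing A with
  | _ n ih =>
  subst hn
  rcases A.eq_empty_or_nonempty with rfl | hne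
  · exact ⟨∅, by simp, by simp, by simp⟩
  have hpos := Finset.card_pos.2 hne
  obtain ⟨Z, hev, hsub, hhalf⟩ := hG.exists_isEvenEdges_half A hA
  by_cases hA1 : #(A \ Z) = 0
  · refine ⟨{Z}, by simp, by simpa using ⟨hev, hsub⟩, fun e he => ⟨Z, by simp, ?_⟩⟩
    exact Finset.sdiff_eq_empty_iff_subset.1 (Finset.card_eq_zero.1 hA1) he
  obtain ⟨Q, hQ, hQe, hQc⟩ := ih #(A \ Z) (by omega) (A \ Z)
    (fun e he => hA (Finset.mem_sdiff.1 (Finset.mem_coe.1 he)).1) rfl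
  refine ⟨insert Z Q, ?_, ?_, ?_⟩
  · have h1 := Finset.card_insert_le Z Q
    have h2 := Nat.log_mono_right (b := 2) hhalf
    have h3 := Nat.log_of_one_lt_of_le (b := 2) (n := #A) (by norm_num) (by omega)
    omega
  · intro Y hY
    rcases Finset.mem_insert.1 hY with rfl | hY
    · exact ⟨hev, hsub⟩
    · exact hQe Y hY
  · intro e he
    by_cases heZ : e ∈ Z
    · exact ⟨Z, Finset.mem_insert_self _ _, heZ⟩
    · obtain ⟨Y, hY, heY⟩ := hQc e (Finset.mem_sdiff.2 ⟨he, heZ⟩)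
      exact ⟨Y, Finset.mem_insert_of_mem hY, heY⟩

end Averaging

/-! ### Root paths of a spanning tree, in lexicographic order -/

theorem lt_or_eq_and_le_of_cons_le_cons {α : Type*} [LinearOrder α] {x y : α} {l m : List α}
    (h : x :: l ≤ y :: m) : x < y ∨ x = y ∧ l ≤ m := by
  rcases h.lt_or_eq with h | h
  · rcases List.cons_lt_cons_iff.1 h with h | h
    · exact Or.inl h
    · exact Or.inr ⟨h.1, h.2.le⟩
  · obtain ⟨h₁, h₂⟩ := List.cons.inj h
    exact Or.inr ⟨h₁, h₂.le⟩

/-- Lists with a common prefix form an interval lexicographically; this makes subtrees intervals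
when vertices are ordered by their root paths. -/
theorem prefix_of_le_of_le {α : Type*} [LinearOrder α] {p l₁ l₂ l₃ : List α} (h₁ : p <+: l₁)
    (h₃ : p <+: l₃) (h₁₂ : l₁ ≤ l₂) (h₂₃ : l₂ ≤ l₃) : p <+: l₂ := by
  induction p generalizing l₁ l₂ l₃ with
  | nil => exact List.nil_prefix
  | cons x p ih =>
    obtain ⟨t₁, rfl⟩ := h₁
    obtain ⟨t₃, rfl⟩ := h₃
    rw [List.cons_append] at h₁₂ h₂₃
    cases l₂ with
    | nil => exact absurd h₁₂ (by simp)
    | cons y l₂ =>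
      replace h₁₂ := lt_or_eq_and_le_of_cons_le_cons h₁₂
      replace h₂₃ := lt_or_eq_and_le_of_cons_le_cons h₂₃
      rcases h₁₂ with h | ⟨rfl, h⟩
      · rcases h₂₃ with h' | ⟨rfl, -⟩
        · exact absurd (h.trans h') (lt_irrefl _)
        · exact absurd h (lt_irrefl _)
      · rcases h₂₃ with h' | ⟨-, h'⟩
        · exact absurd h' (lt_irrefl _)
        · exact (List.cons_prefix_cons).2 ⟨rfl, ih ⟨t₁, rfl⟩ ⟨t₃, rfl⟩ h h'⟩

/-- The set of lists with a given prefix is a difference of two lower sets. -/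
theorem exists_isLowerSet_prefix {α : Type*} [LinearOrder α] (p : List α) :
    ∃ L₁ L₂ : Set (List α), IsLowerSet L₁ ∧ IsLowerSet L₂ ∧
      ∀ l, {l | p <+: l}.indicator (1 : List α → ZMod 2) l = L₁.indicator 1 l + L₂.indicator 1 l := by
  classical
  -- The down-closure of the interval, and the part of it strictly before the interval.
  refine ⟨{l | ∃ l', l ≤ l' ∧ p <+: l'}, {l | (∃ l', l ≤ l' ∧ p <+: l') ∧ ¬ p <+: l}, ?_, ?_, ?_⟩
  · rintro l k hkl ⟨l', hl, hp⟩
    exact ⟨l', hkl.trans hl, hp⟩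
  · rintro l k hkl ⟨⟨l', hl, hp⟩, hn⟩
    exact ⟨⟨l', hkl.trans hl, hp⟩, fun hk => hn (prefix_of_le_of_le hk hp hkl hl)⟩
  · intro l
    by_cases h : p <+: l
    · have h1 : ∃ l', l ≤ l' ∧ p <+: l' := ⟨l, le_rfl, h⟩
      simp only [Set.indicator_apply, Set.mem_ofPred_eq, h, h1, not_true_eq_false, and_false,
        if_true, if_false, add_zero]
    · simp only [Set.indicator_apply, Set.mem_ofPred_eq, h, not_false_eq_true, and_true, if_false]
      rw [CharTwo.add_self_eq_zero]

section RootPath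

variable {V : Type*}

/-- The last `k` vertices on the path to `v` that is obtained by iterating a parent function. -/
def ancestorList (par : V → V) : ℕ → V → List V
  | 0, _ => []
  | k + 1, v => ancestorList par k (par v) ++ [v]

theorem length_ancestorList (par : V → V) (k : ℕ) (v : V) :
    (ancestorList par k v).length = k := by
  induction k generalizing v with
  | zero => rfl
  | succ k ih => simp [ancestorList, ih]

variable {par : V → V} {h : V → ℕ}

theorem height_of_mem_ancestorList (hpar : ∀ v, h v ≠ 0 → h (par v) + 1 = h v)
    {k : ℕ} {v x : V} (hk : h v = k)
    (hx : x ∈ ancestorList par k v) : h x ≠ 0 ∧ h x ≤ k := by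
  induction k generalizing v with
  | zero => simp [ancestorList] at hx
  | succ k ih =>
    rw [ancestorList, List.mem_append, List.mem_singleton] at hx
    rcases hx with hx | rfl
    · have := hpar v (by omega)
      obtain ⟨h1, h2⟩ := ih (v := par v) (by omega) hx
      exact ⟨h1, by omega⟩
    · omega

/-- Being below `x` in the tree becomes a prefix condition. The root, of height 0, is absent from
all lists, so each entry `x` stands for the tree edge from `par x` to `x`. -/
theorem mem_ancestorList_iff (hpar : ∀ v, h v ≠ 0 → h (par v) + 1 = h v)
    {k : ℕ} {v x : V} (hk : h v = k) (hx : h x ≠ 0) :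
    x ∈ ancestorList par k v ↔ ancestorList par (h x) x <+: ancestorList par k v := by
  constructor
  · intro hmem
    induction k generalizing v with
    | zero => simp [ancestorList] at hmem
    | succ k ih =>
      rw [ancestorList, List.mem_append, List.mem_singleton] at hmem
      rcases hmem with hmem | rfl
      · have := hpar v (by omega)
        exact (ih (v := par v) (by omega) hmem).trans (List.prefix_append _ _)
      · rw [hk]
  · intro hp
    refine hp.subset ?_
    obtain ⟨j, hj⟩ := Nat.exists_eq_succ_of_ne_zero hx
    rw [hj, ancestorList]
    simp

/-- If the edges agreed in the reverse direction, each vertex would be the parent of the other,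
contradicting the heights. -/
theorem parent_edge_injective (hpar : ∀ v, h v ≠ 0 → h (par v) + 1 = h v)
    {x y : V} (hx : h x ≠ 0) (hy : h y ≠ 0)
    (hxy : s(par x, x) = s(par y, y)) : x = y := by
  rcases Sym2.eq_iff.1 hxy with ⟨-, h2⟩ | ⟨h1, h2⟩
  · exact h2
  · have h3 := hpar x hx
    have h4 := hpar y hy
    rw [h1] at h3
    rw [← h2] at h4
    omega

theorem endpointSum_ancestorList [DecidableEq V]
    (hpar : ∀ v, h v ≠ 0 → h (par v) + 1 = h v) {k : ℕ} {v r : V} (hk : h v = k)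
    (hr : ∀ v, h v = 0 → v = r) (φ : V → ZMod 2) :
    endpointSum fstEnd sndEnd φ ((ancestorList par k v).toFinset.image fun x => s(par x, x)) =
      φ r + φ v := by
  induction k generalizing v with
  | zero =>
    rw [hr v hk, CharTwo.add_self_eq_zero]
    simp [ancestorList, endpointSum]
  | succ k ih =>
    have hp := hpar v (by omega)
    have ih := ih (v := par v) (by omega)
    rw [ancestorList, List.toFinset_append, Finset.image_union, Finset.union_comm]
    have e : Finset.image (fun x => s(par x, x)) [v].toFinset = {s(par v, v)} := by simp
    rw [e, ← Finset.insert_eq, endpointSum, Finset.sum_insert, add_ends]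
    · rw [endpointSum] at ih
      rw [ih]
      have := CharTwo.add_self_eq_zero (φ (par v))
      linear_combination this
    · intro hmem
      obtain ⟨x, hx, he⟩ := Finset.mem_image.1 hmem
      have hx := height_of_mem_ancestorList hpar (v := par v) (k := k) (by omega)
        (List.mem_toFinset.1 hx)
      have := parent_edge_injective hpar hx.1 (by omega) he
      subst this
      omega

end RootPath

/-- A connected graph has, for each vertex, a short edge set joining it to a fixed root; the vertices
can be linearly preordered such that the set of vertices whose path uses a given edge is a
difference of two lower sets. -/
theorem exists_root_paths {V : Type*} [Fintype V] [LinearOrder V] {G : SimpleGraph V}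
    (hG : G.Connected) :
    ∃ (ℓ : V → List V) (P : V → Finset (Sym2 V)) (r : V),
      (∀ v, #(P v) ≤ G.diam) ∧ (∀ v, (P v : Set (Sym2 V)) ⊆ G.edgeSet) ∧
      (∀ v φ, endpointSum fstEnd sndEnd φ (P v) = φ r + φ v) ∧
      ∀ e, ∃ L₁ L₂ : Set (List V), IsLowerSet L₁ ∧ IsLowerSet L₂ ∧
        ∀ v, (if e ∈ P v then 1 else 0 : ZMod 2) = L₁.indicator 1 (ℓ v) + L₂.indicator 1 (ℓ v) := by
  classical
  have := hG.nonempty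
  let r : V := Classical.arbitrary V
  -- Parents are one step closer to the root along a shortest path; the parent of the root is
  -- arbitrary.
  have hex : ∀ v, ∃ w, G.dist v r ≠ 0 → G.Adj w v ∧ G.dist w r + 1 = G.dist v r := by
    intro v
    obtain ⟨p, hp⟩ := hG.exists_walk_length_eq_dist v r
    by_cases hv : v = r
    · exact ⟨v, fun h => absurd (by rw [hv, SimpleGraph.dist_self]) h⟩
    · cases p with
      | nil => exact absurd rfl hv
      | @cons _ w _ hadj q =>
        refine ⟨w, fun _ => ⟨hadj.symm, ?_⟩⟩
        have h1 := SimpleGraph.dist_le q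
        have h2 : G.dist v r ≤ G.dist v w + G.dist w r := hG.dist_triangle
        rw [SimpleGraph.dist_eq_one_iff_adj.2 hadj] at h2
        rw [SimpleGraph.Walk.length_cons] at hp
        omega
  choose par hpar using hex
  have hpar' : ∀ v, G.dist v r ≠ 0 → G.dist (par v) r + 1 = G.dist v r := fun v hv => (hpar v hv).2
  let ℓ : V → List V := fun v => ancestorList par (G.dist v r) v
  refine ⟨ℓ, fun v => (ℓ v).toFinset.image fun x => s(par x, x), r, ?_, ?_, ?_, ?_⟩
  · intro v
    refine Finset.card_image_le.trans ((List.toFinset_card_le _).trans ?_)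
    rw [length_ancestorList]
    exact SimpleGraph.dist_le_diam (SimpleGraph.connected_iff_ediam_ne_top.1 hG)
  · intro v e he
    obtain ⟨x, hx, rfl⟩ := Finset.mem_image.1 (Finset.mem_coe.1 he)
    exact (hpar x (height_of_mem_ancestorList hpar' rfl (List.mem_toFinset.1 hx)).1).1
  · intro v φ
    exact endpointSum_ancestorList hpar' rfl (fun w hw => hG.dist_eq_zero_iff.1 hw) φ
  · intro e
    by_cases he : ∃ x, G.dist x r ≠ 0 ∧ s(par x, x) = e
    · obtain ⟨x, hx, rfl⟩ := he
      obtain ⟨L₁, L₂, h₁, h₂, h⟩ := exists_isLowerSet_prefix (ℓ x)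
      refine ⟨L₁, L₂, h₁, h₂, fun v => ?_⟩
      rw [← h, Set.indicator_apply]
      refine if_congr ?_ rfl rfl
      rw [Finset.mem_image, Set.mem_ofPred_eq, ← mem_ancestorList_iff hpar' rfl hx]
      constructor
      · rintro ⟨y, hy, hxy⟩
        have hy := List.mem_toFinset.1 hy
        have := parent_edge_injective hpar' (height_of_mem_ancestorList hpar' rfl hy).1 hx hxy
        exact this ▸ hy
      · exact fun hx' => ⟨x, List.mem_toFinset.2 hx', rfl⟩
    -- An edge outside the tree lies on no root path.
    · refine ⟨∅, ∅, isLowerSet_empty, isLowerSet_empty, fun v => ?_⟩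
      rw [if_neg]
      · simp
      · intro hmem
        obtain ⟨x, hx, hxe⟩ := Finset.mem_image.1 hmem
        exact he ⟨x, (height_of_mem_ancestorList hpar' rfl (List.mem_toFinset.1 hx)).1, hxe⟩

/-! ### Cycle covers of bridgeless graphs -/

/-- An even edge set `Z` of a connected graph is contained in a union of small even edge sets with
low congestion. -/
theorem IsEvenEdges.exists_small_cover {V : Type*} [Fintype V] [LinearOrder V] {G : SimpleGraph V}
    (hG : G.Connected) {Z : Finset (Sym2 V)} (hZ : IsEvenEdges Z)
    (hZG : (Z : Set (Sym2 V)) ⊆ G.edgeSet) :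
    ∃ Q : Finset (Finset (Sym2 V)),
      (∀ C ∈ Q, IsEvenEdges C ∧ (C : Set (Sym2 V)) ⊆ G.edgeSet ∧
        #C ≤ (2 * Nat.log 2 #Z + 3) * (2 * G.diam + 1)) ∧
      (∀ e ∈ Z, ∃ C ∈ Q, e ∈ C) ∧
      ∀ e, #(Q.filter fun C => e ∈ C) ≤ 32 * Nat.log 2 #Z + 17 := by
  classical
  obtain ⟨ℓ, P, r, hPcard, hPG, hPsum, hPL⟩ := exists_root_paths hG
  obtain ⟨𝒮, hd, hu, hcard, hodd⟩ :=
    exists_grouping (fun e => ℓ (fstEnd e)) (fun e => ℓ (sndEnd e)) Z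
  let ind : Finset (Sym2 V) → Sym2 V → ZMod 2 := fun S e => if e ∈ S then 1 else 0
  -- The sum modulo 2 of the closed walks of the edges in `S`; `C S` is its support.
  let c : Finset (Sym2 V) → Sym2 V → ZMod 2 := fun S e =>
    ∑ f ∈ S, (ind {f} e + (ind (P (fstEnd f)) e + ind (P (sndEnd f)) e))
  let C : Finset (Sym2 V) → Finset (Sym2 V) := fun S => Finset.univ.filter fun e => c S e ≠ 0
  have hsub : ∀ S, C S ⊆ S.biUnion fun f => {f} ∪ (P (fstEnd f) ∪ P (sndEnd f)) := by
    intro S e he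
    obtain ⟨-, he⟩ := Finset.mem_filter.1 he
    obtain ⟨f, hf, hfe⟩ := Finset.exists_ne_zero_of_sum_ne_zero he
    refine Finset.mem_biUnion.2 ⟨f, hf, ?_⟩
    by_contra hcon
    simp only [Finset.mem_union, not_or] at hcon
    apply hfe
    simp [ind, hcon.2.1, hcon.2.2, Finset.mem_singleton.not.1 hcon.1]
  have hSZ : ∀ S ∈ 𝒮, S ⊆ Z := fun S hS => hu ▸ Finset.subset_biUnion_of_mem id hS
  have hone : ∀ x : ZMod 2, x ≠ 0 → x = 1 := by decide
  have hindsum : ∀ (T : Finset (Sym2 V)) (g : Sym2 V → ZMod 2),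
      ∑ e, ind T e * g e = ∑ e ∈ T, g e := by
    intro T g
    simp [ind, ite_mul]
  have hCsum : ∀ S (g : Sym2 V → ZMod 2), ∑ e ∈ C S, g e =
      ∑ f ∈ S, (g f + (∑ e ∈ P (fstEnd f), g e + ∑ e ∈ P (sndEnd f), g e)) := by
    intro S g
    have h1 : ∑ e ∈ C S, g e = ∑ e, c S e * g e := by
      rw [Finset.sum_filter]
      refine Finset.sum_congr rfl fun e _ => ?_
      split_ifs with h
      · rw [hone _ h, one_mul]
      · rw [not_not.1 h, zero_mul]
    rw [h1]
    simp only [c, Finset.sum_mul]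
    rw [Finset.sum_comm]
    refine Finset.sum_congr rfl fun f _ => ?_
    simp only [add_mul, Finset.sum_add_distrib, hindsum, Finset.sum_singleton]
  refine ⟨𝒮.image C, ?_, ?_, ?_⟩
  · intro C' hC'
    obtain ⟨S, hS, rfl⟩ := Finset.mem_image.1 hC'
    refine ⟨fun φ => ?_, fun e he => ?_, ?_⟩
    · rw [endpointSum, hCsum]
      refine Finset.sum_eq_zero fun f _ => ?_
      have h1 := hPsum (fstEnd f) φ
      have h2 := hPsum (sndEnd f) φ
      rw [endpointSum] at h1 h2
      rw [h1, h2]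
      have h4 := CharTwo.add_self_eq_zero (φ r)
      have h5 := CharTwo.add_self_eq_zero (φ (fstEnd f))
      have h6 := CharTwo.add_self_eq_zero (φ (sndEnd f))
      linear_combination h4 + h5 + h6
    · obtain ⟨f, hf, he⟩ := Finset.mem_biUnion.1 (hsub S (Finset.mem_coe.1 he))
      simp only [Finset.mem_union, Finset.mem_singleton] at he
      rcases he with rfl | he | he
      · exact hZG (hSZ S hS hf)
      · exact hPG _ he
      · exact hPG _ he
    · refine (Finset.card_le_card (hsub S)).trans
        ((Finset.card_biUnion_le_card_mul _ _ (2 * G.diam + 1) fun f _ => ?_).trans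
          (Nat.mul_le_mul_right _ (hcard S hS)))
      have h1 := Finset.card_union_le {f} (P (fstEnd f) ∪ P (sndEnd f))
      have h2 := Finset.card_union_le (P (fstEnd f)) (P (sndEnd f))
      have h3 := hPcard (fstEnd f)
      have h4 := hPcard (sndEnd f)
      rw [Finset.card_singleton] at h1
      omega
  · intro e he
    -- Over all groups the root paths cancel because `Z` is even, leaving the indicator of `Z`. So
    -- each edge of `Z` survives in some `C S`.
    have htot : ∑ S ∈ 𝒮, c S e = 1 := by
      have h1 : ∑ S ∈ 𝒮, c S e =
          ∑ f ∈ Z, (ind {f} e + (ind (P (fstEnd f)) e + ind (P (sndEnd f)) e)) := by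
        rw [← hu, Finset.sum_biUnion hd]
        rfl
      rw [h1, Finset.sum_add_distrib]
      have h2 := hZ fun v => ind (P v) e
      rw [endpointSum] at h2
      rw [h2, add_zero]
      simp [ind, he]
    obtain ⟨S, hS, hne⟩ : ∃ S ∈ 𝒮, c S e ≠ 0 :=
      Finset.exists_ne_zero_of_sum_ne_zero (by rw [htot]; exact one_ne_zero)
    exact ⟨C S, Finset.mem_image_of_mem _ hS, Finset.mem_filter.2 ⟨Finset.mem_univ _, hne⟩⟩
  · intro e
    obtain ⟨L₁, L₂, h₁, h₂, hL⟩ := hPL e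
    rw [Finset.filter_image]
    refine Finset.card_image_le.trans ?_
    -- Outside its own group, `e` survives only if an odd number of endpoints of `S` have root paths
    -- through `e`. That parity is the sum of two lower-set parities, one of which must be odd. The
    -- total is `1 + 2 * (16 * Nat.log 2 #Z + 8)`.
    have hsplit : (𝒮.filter fun S => e ∈ C S) ⊆ (𝒮.filter fun S => e ∈ S) ∪
        ((𝒮.filter fun S => endpointSum (fun e => ℓ (fstEnd e)) (fun e => ℓ (sndEnd e))
            (L₁.indicator 1) S ≠ 0) ∪
          (𝒮.filter fun S => endpointSum (fun e => ℓ (fstEnd e)) (fun e => ℓ (sndEnd e))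
            (L₂.indicator 1) S ≠ 0)) := by
      intro S hS
      obtain ⟨hS𝒮, heC⟩ := Finset.mem_filter.1 hS
      obtain ⟨-, hne⟩ := Finset.mem_filter.1 heC
      by_contra hcon
      simp only [Finset.mem_union, Finset.mem_filter, hS𝒮, true_and, not_or, not_not] at hcon
      obtain ⟨h3, h4, h5⟩ := hcon
      apply hne
      have h6 : c S e = ∑ f ∈ S, ind {f} e +
          (endpointSum (fun e => ℓ (fstEnd e)) (fun e => ℓ (sndEnd e)) (L₁.indicator 1) S +
          endpointSum (fun e => ℓ (fstEnd e)) (fun e => ℓ (sndEnd e)) (L₂.indicator 1) S) := by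
        simp only [c, endpointSum, ← Finset.sum_add_distrib, ind, hL]
        refine Finset.sum_congr rfl fun f _ => ?_
        ring
      rw [h6, h4, h5]
      simp [ind, h3]
    have hle1 : #(𝒮.filter fun S => e ∈ S) ≤ 1 := by
      rw [Finset.card_le_one]
      intro S hS T hT
      obtain ⟨hS, heS⟩ := Finset.mem_filter.1 hS
      obtain ⟨hT, heT⟩ := Finset.mem_filter.1 hT
      by_contra hne
      exact Finset.disjoint_left.1 (hd hS hT hne) heS heT
    have h7 := hodd L₁ h₁
    have h8 := hodd L₂ h₂
    refine (Finset.card_le_card hsplit).trans ((Finset.card_union_le _ _).trans ?_)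
    refine (Nat.add_le_add hle1 ((Finset.card_union_le _ _).trans (Nat.add_le_add h7 h8))).trans ?_
    omega

theorem hasCycleCover_of_finset {V : Type*} {G : SimpleGraph V} {d c : ℕ}
    (Q : Finset (Finset (Sym2 V))) (hQ : ∀ S ∈ Q, IsCycleEdges G S ∧ #S ≤ d)
    (hcov : ∀ e ∈ G.edgeSet, ∃ S ∈ Q, e ∈ S)
    (hcon : ∀ e ∈ G.edgeSet, {S | S ∈ Q ∧ e ∈ S}.ncard ≤ c) : HasCycleCover G d c := by
  classical
  have h : ∀ i : Fin #Q, ∃ (v : V) (p : G.Walk v v), p.IsCycle ∧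
      ∀ e, e ∈ (Q.equivFin.symm i : Finset (Sym2 V)) ↔ e ∈ p.edges :=
    fun i => (hQ _ (Q.equivFin.symm i).2).1
  choose v p hp hmem using h
  refine ⟨#Q, v, p, hp, fun i => ?_, fun e he => ⟨?_, ?_⟩⟩
  · have h1 := (hQ _ (Q.equivFin.symm i).2).2
    have h2 : (Q.equivFin.symm i : Finset (Sym2 V)) = (p i).edges.toFinset := by
      ext e
      simp [hmem]
    rw [h2, List.toFinset_card_of_nodup (hp i).isCircuit.isTrail.edges_nodup,
      SimpleGraph.Walk.length_edges] at h1
    exact h1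
  · obtain ⟨S, hS, heS⟩ := hcov e he
    refine ⟨Q.equivFin ⟨S, hS⟩, (hmem _ e).1 ?_⟩
    simpa using heS
  · refine le_trans (Set.ncard_le_ncard_of_injOn
      (fun i => (Q.equivFin.symm i : Finset (Sym2 V))) ?_ ?_ ?_) (hcon e he)
    · intro i hi
      exact ⟨(Q.equivFin.symm i).2, (hmem i e).2 hi⟩
    · intro i _ j _ hij
      exact Q.equivFin.symm.injective (Subtype.ext hij)
    · exact Q.finite_toSet.subset fun S hS => hS.1

/-- A bridgeless graph has a cycle cover whose cycles have length `O(D log m)` and whose congestion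
is `O(log² m)`. -/
theorem IsBridgeless.hasCycleCover {V : Type*} [Fintype V] [LinearOrder V] {G : SimpleGraph V}
    (hG : IsBridgeless G) {q : ℕ} (hq : Nat.log 2 G.edgeSet.ncard ≤ q) :
    HasCycleCover G ((2 * q + 3) * (2 * G.diam + 1)) ((q + 1) * (32 * q + 17)) := by
  classical
  set E : Finset (Sym2 V) := G.edgeFinset with hE
  have hEG : (E : Set (Sym2 V)) = G.edgeSet := by simp [hE]
  have hEcard : #E = G.edgeSet.ncard := by rw [← hEG, Set.ncard_coe_finset]
  obtain ⟨𝒵, hcard, h𝒵, hcov⟩ := hG.exists_isEvenEdges_cover E hEG.subset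
  have h1 : ∀ Z ∈ 𝒵, ∃ Q : Finset (Finset (Sym2 V)),
      (∀ C ∈ Q, IsEvenEdges C ∧ (C : Set (Sym2 V)) ⊆ G.edgeSet ∧
        #C ≤ (2 * q + 3) * (2 * G.diam + 1)) ∧
      (∀ e ∈ Z, ∃ C ∈ Q, e ∈ C) ∧ ∀ e, #(Q.filter fun C => e ∈ C) ≤ 32 * q + 17 := by
    intro Z hZ
    obtain ⟨Q, h1, h2, h3⟩ := (h𝒵 Z hZ).1.exists_small_cover hG.1 (h𝒵 Z hZ).2
    have hle : Nat.log 2 #Z ≤ q := by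
      refine le_trans (Nat.log_mono_right ?_) (hEcard ▸ hq)
      refine Finset.card_le_card fun e he => ?_
      rw [← Finset.mem_coe, hEG]
      exact (h𝒵 Z hZ).2 he
    refine ⟨Q, fun C hC => ⟨(h1 C hC).1, (h1 C hC).2.1, (h1 C hC).2.2.trans ?_⟩, h2,
      fun e => (h3 e).trans (by omega)⟩
    exact Nat.mul_le_mul_right _ (by omega)
  choose! Q hQ hQcov hQcon using h1
  -- The hypotheses sit inside the existential so that `P` can be chosen as a function on all edge
  -- sets.
  have h2 : ∀ C : Finset (Sym2 V), ∃ P : Finset (Finset (Sym2 V)), IsEvenEdges C →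
      (C : Set (Sym2 V)) ⊆ G.edgeSet → (P : Set (Finset (Sym2 V))).PairwiseDisjoint id ∧
        P.biUnion id = C ∧ ∀ S ∈ P, IsCycleEdges G S := by
    intro C
    by_cases h : IsEvenEdges C ∧ (C : Set (Sym2 V)) ⊆ G.edgeSet
    · obtain ⟨P, hP⟩ := h.1.exists_cycle_partition h.2
      exact ⟨P, fun _ _ => hP⟩
    · exact ⟨∅, fun h3 h4 => absurd ⟨h3, h4⟩ h⟩
  choose P hP using h2
  have hsub : ∀ Z ∈ 𝒵, ∀ C ∈ Q Z, ∀ S ∈ P C, S ⊆ C := fun Z hZ C hC S hS =>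
    (hP C (hQ Z hZ C hC).1 (hQ Z hZ C hC).2.1).2.1 ▸ Finset.subset_biUnion_of_mem id hS
  refine hasCycleCover_of_finset (𝒵.biUnion fun Z => (Q Z).biUnion P) ?_ ?_ ?_
  · intro S hS
    obtain ⟨Z, hZ, hS⟩ := Finset.mem_biUnion.1 hS
    obtain ⟨C, hC, hS⟩ := Finset.mem_biUnion.1 hS
    obtain ⟨hev, hCG, hCcard⟩ := hQ Z hZ C hC
    exact ⟨(hP C hev hCG).2.2 S hS, (Finset.card_le_card (hsub Z hZ C hC S hS)).trans hCcard⟩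
  · intro e he
    obtain ⟨Z, hZ, heZ⟩ := hcov e (by rwa [← Finset.mem_coe, hEG])
    obtain ⟨C, hC, heC⟩ := hQcov Z hZ e heZ
    obtain ⟨hev, hCG, -⟩ := hQ Z hZ C hC
    rw [← (hP C hev hCG).2.1] at heC
    obtain ⟨S, hS, heS⟩ := Finset.mem_biUnion.1 heC
    exact ⟨S, Finset.mem_biUnion.2 ⟨Z, hZ, Finset.mem_biUnion.2 ⟨C, hC, hS⟩⟩, heS⟩
  · intro e _
    have heq : {S | S ∈ 𝒵.biUnion (fun Z => (Q Z).biUnion P) ∧ e ∈ S} =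
        (((𝒵.biUnion fun Z => (Q Z).biUnion P).filter fun S => e ∈ S : Finset _) :
          Set (Finset (Sym2 V))) := by
      ext S
      simp
    rw [heq, Set.ncard_coe_finset, Finset.filter_biUnion]
    refine (Finset.card_biUnion_le_card_mul _ _ (32 * q + 17) fun Z hZ => ?_).trans
      (Nat.mul_le_mul_right _ ?_)
    · refine le_trans ?_ (hQcon Z hZ e)
      -- The cycles of one `C` are disjoint, so each `C` containing `e` contributes at most one
      -- cycle through `e`.
      refine Finset.card_le_card_of_forall_subsingleton (fun S C => S ∈ P C) ?_ ?_
      · intro S hS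
        obtain ⟨hS, heS⟩ := Finset.mem_filter.1 hS
        obtain ⟨C, hC, hSC⟩ := Finset.mem_biUnion.1 hS
        exact ⟨C, Finset.mem_filter.2 ⟨hC, hsub Z hZ C hC S hSC heS⟩, hSC⟩
      · rintro C hC S ⟨hS, hSC⟩ T ⟨hT, hTC⟩
        have hC := (Finset.mem_filter.1 hC).1
        obtain ⟨hev, hCG, -⟩ := hQ Z hZ C hC
        by_contra hne
        exact Finset.disjoint_left.1 ((hP C hev hCG).1 hSC hTC hne)
          (Finset.mem_filter.1 hS).2 (Finset.mem_filter.1 hT).2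
    · rw [hEcard] at hcard
      omega

/-! ### The gadget graph -/

section Gadget

variable {V : Type*} (G : SimpleGraph V) (κ : V → V → V)

/-- The vertices of the gadget graph: a vertex `u` together with the label of one of its
neighbors. -/
def GadgetNode : Type _ := {x : V × V // ∃ v, G.Adj x.1 v ∧ κ x.1 v = x.2}

variable {G κ}

namespace GadgetNode

/-- The vertex of the original graph to which a gadget node belongs. -/
def base (x : GadgetNode G κ) : V := x.1.1

/-- The label of a gadget node. -/
def label (x : GadgetNode G κ) : V := x.1.2

variable (κ) in
/-- The node of the gadget of `u` that is attached to the neighbor `v`. -/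
def ofAdj {u v : V} (h : G.Adj u v) : GadgetNode G κ := ⟨(u, κ u v), v, h, rfl⟩

theorem ext {x y : GadgetNode G κ} (hb : x.base = y.base) (hl : x.label = y.label) : x = y :=
  Subtype.ext (Prod.ext hb hl)

theorem exists_eq_ofAdj (x : GadgetNode G κ) : ∃ (v : V) (h : G.Adj x.base v), x = ofAdj κ h := by
  obtain ⟨v, h, hl⟩ := x.2
  exact ⟨v, h, ext rfl hl.symm⟩

end GadgetNode

open GadgetNode

variable (κ) {nb : V → V} (hnb : ∀ u, G.Adj u (nb u))

/-- The central node of the gadget of `u`. -/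
def hubNode (u : V) : GadgetNode G κ := ofAdj κ (hnb u)

/-- The gadget graph: each vertex `u` is replaced by a star with one node for each label of a
neighbor of `u`, and an edge `uv` joins the nodes with the labels of `v` and `u`. -/
def gadgetGraph : SimpleGraph (GadgetNode G κ) where
  Adj x y := (x.base = y.base ∧ x ≠ y ∧ (x = hubNode κ hnb x.base ∨ y = hubNode κ hnb y.base)) ∨
    (G.Adj x.base y.base ∧ κ x.base y.base = x.label ∧ κ y.base x.base = y.label)
  symm := ⟨by
    rintro x y (⟨h1, h2, h3⟩ | ⟨h1, h2, h3⟩)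
    · exact Or.inl ⟨h1.symm, h2.symm, h3.symm⟩
    · exact Or.inr ⟨h1.symm, h3, h2⟩⟩
  loopless := ⟨by
    rintro x (⟨-, h, -⟩ | ⟨h, -, -⟩)
    · exact h rfl
    · exact h.ne rfl⟩

variable {κ}

theorem gadgetGraph_adj_hubNode {x : GadgetNode G κ} (hx : x ≠ hubNode κ hnb x.base) :
    (gadgetGraph κ hnb).Adj x (hubNode κ hnb x.base) :=
  Or.inl ⟨rfl, hx, Or.inr rfl⟩

theorem gadgetGraph_adj_ofAdj {u v : V} (h : G.Adj u v) :
    (gadgetGraph κ hnb).Adj (ofAdj κ h) (ofAdj κ h.symm) :=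
  Or.inr ⟨h, rfl, rfl⟩

theorem exists_walk_of_base_eq {x y : GadgetNode G κ} (h : x.base = y.base) :
    ∃ p : (gadgetGraph κ hnb).Walk x y, p.length ≤ 2 := by
  have key : ∀ z : GadgetNode G κ,
      ∃ p : (gadgetGraph κ hnb).Walk z (hubNode κ hnb z.base), p.length ≤ 1 := by
    intro z
    by_cases hz : z = hubNode κ hnb z.base
    · exact ⟨SimpleGraph.Walk.nil.copy rfl hz, by simp⟩
    · exact ⟨(gadgetGraph_adj_hubNode hnb hz).toWalk, by simp⟩
  obtain ⟨p, hp⟩ := key x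
  have hy := key y
  rw [← h] at hy
  obtain ⟨q, hq⟩ := hy
  refine ⟨p.append q.reverse, ?_⟩
  rw [SimpleGraph.Walk.length_append, SimpleGraph.Walk.length_reverse]
  omega

/-- Each edge of the walk costs one crossing, and each of its `p.length + 1` gadgets at most two
star edges. -/
theorem exists_gadget_walk {u v : V} (p : G.Walk u v) (x y : GadgetNode G κ) (hx : x.base = u)
    (hy : y.base = v) : ∃ q : (gadgetGraph κ hnb).Walk x y, q.length ≤ 3 * p.length + 2 := by
  induction p generalizing x with
  | nil => exact exists_walk_of_base_eq hnb (hx.trans hy.symm)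
  | @cons u w v h p ih =>
    obtain ⟨q₁, h₁⟩ := exists_walk_of_base_eq hnb (x := x) (y := ofAdj κ h) hx
    obtain ⟨q₂, h₂⟩ := ih (ofAdj κ h.symm) rfl hy
    refine ⟨q₁.append (.cons (gadgetGraph_adj_ofAdj hnb h) q₂), ?_⟩
    rw [SimpleGraph.Walk.length_append, SimpleGraph.Walk.length_cons,
      SimpleGraph.Walk.length_cons]
    omega

theorem gadgetGraph_connected (hG : G.Connected) : (gadgetGraph κ hnb).Connected := by
  have : Nonempty (GadgetNode G κ) := hG.nonempty.map (hubNode κ hnb)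
  refine ⟨fun x y => ?_⟩
  obtain ⟨p⟩ := hG.preconnected x.base y.base
  obtain ⟨q, -⟩ := exists_gadget_walk hnb p x y rfl rfl
  exact ⟨q⟩

theorem exists_gadget_walk_le_diam [Finite V] (hG : G.Connected) (x y : GadgetNode G κ) :
    ∃ q : (gadgetGraph κ hnb).Walk x y, q.length ≤ 3 * G.diam + 2 := by
  have := hG.nonempty
  obtain ⟨p, hp⟩ := hG.exists_walk_length_eq_dist x.base y.base
  obtain ⟨q, hq⟩ := exists_gadget_walk hnb p x y rfl rfl
  have : G.dist x.base y.base ≤ G.diam :=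
    SimpleGraph.dist_le_diam (SimpleGraph.connected_iff_ediam_ne_top.1 hG)
  exact ⟨q, by omega⟩

/-- Walks inside `X` lift to every graph that contains all edges between gadgets of vertices
in `X`. -/
theorem reachable_of_induce_reachable {X : Set V} {K : SimpleGraph (GadgetNode G κ)}
    (hK : ∀ x y, (gadgetGraph κ hnb).Adj x y → x.base ∈ X → y.base ∈ X → K.Adj x y)
    {u v : X} (huv : (G.induce X).Reachable u v) (x y : GadgetNode G κ) (hx : x.base = u)
    (hy : y.base = v) : K.Reachable x y := by
  have hub : ∀ z : GadgetNode G κ, z.base ∈ X → K.Reachable z (hubNode κ hnb z.base) := by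
    intro z hz
    by_cases h : z = hubNode κ hnb z.base
    · rw [← h]
    · exact (hK _ _ (gadgetGraph_adj_hubNode hnb h) hz hz).reachable
  have same : ∀ z w : GadgetNode G κ, z.base = w.base → z.base ∈ X → K.Reachable z w := by
    intro z w h hz
    have h1 := hub z hz
    have h2 := hub w (h ▸ hz)
    rw [← h] at h2
    exact h1.trans h2.symm
  obtain ⟨p⟩ := huv
  induction p generalizing x with
  | nil => exact same x y (hx.trans hy.symm) (hx ▸ Subtype.coe_prop _)
  | @cons u w v h p ih =>
    have h' : G.Adj u w := h
    refine (same x (ofAdj κ h') hx (hx ▸ u.2)).trans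
      (SimpleGraph.Reachable.trans ?_ (ih (ofAdj κ h'.symm) rfl hy))
    exact (hK _ _ (gadgetGraph_adj_ofAdj hnb h') u.2 w.2).reachable

theorem isBridgeless_of_reachable {W : Type*} {H : SimpleGraph W} (hH : H.Connected)
    (h : ∀ x y, H.Adj x y → (H.deleteEdges {s(x, y)}).Reachable x y) : IsBridgeless H := by
  refine ⟨hH, fun e he => ?_⟩
  induction e using Sym2.ind with
  | _ x y =>
  refine hH.connected_delete_edge_of_not_isBridge ?_
  rw [SimpleGraph.isBridge_iff, not_not]
  exact h x y he

/-- A deleted edge at the gadget of `u` is bypassed by leaving that gadget along another edge and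
travelling through `G` without `u`. The degree condition supplies this other edge when the deleted
edge comes from `G`. -/
theorem gadgetGraph_isBridgeless (hG : IsTwoVertexConnected G)
    (hdeg : ∀ u v, G.Adj u v → ∃ w, w ≠ v ∧ G.Adj u w) : IsBridgeless (gadgetGraph κ hnb) := by
  refine isBridgeless_of_reachable (gadgetGraph_connected hnb hG.1) fun x y hxy => ?_
  set K := (gadgetGraph κ hnb).deleteEdges {s(x, y)} with hKdef
  have hKadj : ∀ z w, (gadgetGraph κ hnb).Adj z w → s(z, w) ≠ s(x, y) → K.Adj z w := by
    intro z w h1 h2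
    rw [hKdef, SimpleGraph.deleteEdges_adj]
    exact ⟨h1, h2⟩
  have hKbase : ∀ z w, (gadgetGraph κ hnb).Adj z w →
      s(z.base, w.base) ≠ s(x.base, y.base) → K.Adj z w := fun z w h1 h2 =>
    hKadj z w h1 fun h => h2 (congrArg (Sym2.map base) h)
  have havoid : ∀ z w, (gadgetGraph κ hnb).Adj z w → z.base ∈ ({x.base}ᶜ : Set V) →
      w.base ∈ ({x.base}ᶜ : Set V) → K.Adj z w := by
    intro z w h hz hw
    refine hKbase z w h fun h => ?_
    rcases Sym2.eq_iff.1 h with ⟨h, -⟩ | ⟨-, h⟩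
    · exact hz h
    · exact hw h
  have hreach : ∀ z w : GadgetNode G κ, z.base ≠ x.base → w.base ≠ x.base → K.Reachable z w :=
    fun z w hz hw => reachable_of_induce_reachable hnb havoid
      ((hG.2 x.base).preconnected ⟨z.base, hz⟩ ⟨w.base, hw⟩) z w rfl rfl
  rcases hxy with ⟨hb, hne, -⟩ | ⟨hadj, hx, hy⟩
  -- Star edge: both ends have an edge to a neighboring gadget, and those gadgets are connected away
  -- from `x.base`.
  · obtain ⟨v, hv, hxv⟩ := x.exists_eq_ofAdj
    obtain ⟨w, hw, hyw⟩ := y.exists_eq_ofAdj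
    have h1 : K.Adj x (ofAdj κ hv.symm) := by
      refine hKbase _ _ ?_ fun h => ?_
      · exact (congrArg (fun z => (gadgetGraph κ hnb).Adj z (ofAdj κ hv.symm)) hxv).mpr
          (gadgetGraph_adj_ofAdj hnb hv)
      · rw [← hb] at h
        have := Sym2.congr_right.1 h
        exact hv.ne this.symm
    have h2 : K.Adj y (ofAdj κ hw.symm) := by
      refine hKbase _ _ ?_ fun h => ?_
      · exact (congrArg (fun z => (gadgetGraph κ hnb).Adj z (ofAdj κ hw.symm)) hyw).mpr
          (gadgetGraph_adj_ofAdj hnb hw)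
      · rw [hb] at h
        have := Sym2.congr_right.1 h
        exact hw.ne this.symm
    refine h1.reachable.trans ((hreach (ofAdj κ hv.symm) (ofAdj κ hw.symm) hv.ne' ?_).trans h2.symm.reachable)
    rw [hb]
    exact hw.ne'
  -- Edge from `G`: the star of `x.base` is intact, so another neighbor `w` is reachable through it.
  · obtain ⟨w, hwv, hw⟩ := hdeg _ _ hadj
    have hin : K.Reachable x (ofAdj κ hw) := by
      refine reachable_of_induce_reachable hnb (X := {x.base}) (u := ⟨x.base, rfl⟩)
        (v := ⟨x.base, rfl⟩) ?_ (SimpleGraph.Reachable.refl _) _ _ rfl rfl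
      intro z z' h hz hz'
      refine hKbase z z' h fun h => ?_
      rw [Set.mem_singleton_iff.1 hz, Set.mem_singleton_iff.1 hz'] at h
      exact hadj.ne (Sym2.congr_right.1 h)
    have hout : K.Adj (ofAdj κ hw) (ofAdj κ hw.symm) := by
      refine hKbase _ _ (gadgetGraph_adj_ofAdj hnb hw) fun h => ?_
      exact hwv (Sym2.congr_right.1 h)
    exact hin.trans (hout.reachable.trans (hreach (ofAdj κ hw.symm) y hw.ne' hadj.ne'))

/-- Every node comes from a dart of `G`; darts at one vertex with equal labels share a node. -/
theorem card_gadgetNode_le [Fintype V] :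
    Nat.card (GadgetNode G κ) ≤ 2 * G.edgeSet.ncard := by
  classical
  have h1 : Nat.card (GadgetNode G κ) ≤ Nat.card G.Dart := by
    refine Nat.card_le_card_of_surjective (fun d : G.Dart => ofAdj κ d.adj) fun x => ?_
    obtain ⟨v, h, hx⟩ := x.exists_eq_ofAdj
    exact ⟨⟨(_, v), h⟩, hx.symm⟩
  rwa [Nat.card_eq_fintype_card (α := G.Dart), SimpleGraph.dart_card_eq_twice_card_edges,
    ← Set.ncard_coe_finset, SimpleGraph.coe_edgeFinset] at h1

end Gadget

/-! ### Transport along isomorphisms -/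

section Transport

variable {W W' : Type*} {H : SimpleGraph W} {H' : SimpleGraph W'}

theorem IsBridgeless.of_iso (f : H ≃g H') (hH : IsBridgeless H) : IsBridgeless H' := by
  refine isBridgeless_of_reachable (f.connected_iff.1 hH.1) fun x y hxy => ?_
  have hadj : H.Adj (f.symm x) (f.symm y) := f.symm.map_adj_iff.2 hxy
  have h := (hH.2 s(f.symm x, f.symm y) hadj).preconnected (f.symm x) (f.symm y)
  let g : H.deleteEdges {s(f.symm x, f.symm y)} →g H'.deleteEdges {s(x, y)} :=
    { toFun := f
      map_rel' := by
        intro a b hab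
        rw [SimpleGraph.deleteEdges_adj] at hab ⊢
        refine ⟨f.map_adj_iff.2 hab.1, fun h => hab.2 ?_⟩
        have := congrArg (Sym2.map f.symm) (Set.mem_singleton_iff.1 h)
        simpa using this }
  have := h.map g
  simpa [g] using this

theorem diam_le_of_iso [Nonempty W'] (f : H ≃g H') {k : ℕ}
    (h : ∀ x y, ∃ p : H.Walk x y, p.length ≤ k) : H'.diam ≤ k := by
  obtain ⟨x, y, hxy⟩ := H'.exists_dist_eq_diam
  rw [← hxy]
  obtain ⟨p, hp⟩ := h (f.symm x) (f.symm y)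
  have h1 := SimpleGraph.dist_le (p.map f.toHom)
  rw [SimpleGraph.Walk.length_map] at h1
  have e1 : f.toHom (f.symm x) = x := f.apply_symm_apply x
  have e2 : f.toHom (f.symm y) = y := f.apply_symm_apply y
  rw [e1, e2] at h1
  exact h1.trans hp

theorem HasCycleCover.of_iso (f : H ≃g H') {d c : ℕ} (h : HasCycleCover H d c) :
    HasCycleCover H' d c := by
  obtain ⟨k, v, p, hp, hd, hc⟩ := h
  have hedge : ∀ e i, e ∈ ((p i).map f.toHom).edges ↔ e.map f.symm ∈ (p i).edges := by
    intro e i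
    rw [SimpleGraph.Walk.edges_map, List.mem_map]
    constructor
    · rintro ⟨e', he', rfl⟩
      induction e' using Sym2.ind with
      | _ x y =>
        change s(f.symm (f x), f.symm (f y)) ∈ _
        rwa [f.symm_apply_apply, f.symm_apply_apply]
    · intro he
      refine ⟨_, he, ?_⟩
      induction e using Sym2.ind with
      | _ x y =>
        change s(f (f.symm x), f (f.symm y)) = _
        rw [f.apply_symm_apply, f.apply_symm_apply]
  refine ⟨k, fun i => f.toHom (v i), fun i => (p i).map f.toHom,
    fun i => (hp i).map f.injective, fun i => ?_, fun e he => ?_⟩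
  · rw [SimpleGraph.Walk.length_map]
    exact hd i
  · have he' : e.map f.symm ∈ H.edgeSet := by
      induction e using Sym2.ind with
      | _ x y => exact f.symm.map_adj_iff.2 he
    simp only [hedge]
    exact hc _ he'

end Transport

open GadgetNode

/-! ### Merging label classes by cycles of the gadget graph -/

section Merging

variable {V : Type*} {G : SimpleGraph V} {κ : V → V → V} {nb : V → V}
  (hnb : ∀ u, G.Adj u (nb u))

variable (κ) in
/-- The edge `f` of the gadget graph is the one that corresponds to the edge `e` of `G`. -/
def IsLift (e : Sym2 V) (f : Sym2 (GadgetNode G κ)) : Prop :=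
  ∃ (a b : V) (h : G.Adj a b), e = s(a, b) ∧ f = s(ofAdj κ h, ofAdj κ h.symm)

theorem IsLift.map_base {e : Sym2 V} {f : Sym2 (GadgetNode G κ)} (h : IsLift κ e f) :
    f.map base = e := by
  obtain ⟨a, b, h, rfl, rfl⟩ := h
  rfl

theorem IsLift.mem_edgeSet {e : Sym2 V} {f : Sym2 (GadgetNode G κ)} (h : IsLift κ e f) :
    e ∈ G.edgeSet := by
  obtain ⟨a, b, h, rfl, rfl⟩ := h
  exact h

theorem IsLift.mem_gadgetGraph {e : Sym2 V} {f : Sym2 (GadgetNode G κ)} (h : IsLift κ e f) :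
    f ∈ (gadgetGraph κ hnb).edgeSet := by
  obtain ⟨a, b, h, rfl, rfl⟩ := h
  exact gadgetGraph_adj_ofAdj hnb h

theorem IsLift.unique {e : Sym2 V} {f f' : Sym2 (GadgetNode G κ)} (h : IsLift κ e f)
    (h' : IsLift κ e f') : f = f' := by
  obtain ⟨a, b, h, rfl, rfl⟩ := h
  obtain ⟨a', b', h', he, rfl⟩ := h'
  rcases Sym2.eq_iff.1 he with ⟨rfl, rfl⟩ | ⟨rfl, rfl⟩
  · rfl
  · exact Sym2.eq_swap

theorem isLift_of_adj {x y : GadgetNode G κ} (h : G.Adj x.base y.base)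
    (hx : κ x.base y.base = x.label) (hy : κ y.base x.base = y.label) :
    IsLift κ s(x.base, y.base) s(x, y) := by
  exact ⟨_, _, h, rfl, congrArg₂ (fun a b => s(a, b))
    (GadgetNode.ext (x := x) (y := ofAdj κ h) rfl hx.symm)
    (GadgetNode.ext (x := y) (y := ofAdj κ h.symm) rfl hy.symm)⟩

/-- A walk of the gadget graph that enters the gadget of `u` avoiding the node `x` reaches a neighbor
of `u` with a label other than that of `x`. -/
theorem exists_reachable_of_walk {K : SimpleGraph (GadgetNode G κ)} (hK : K ≤ gadgetGraph κ hnb)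
    {R : Set (Sym2 V)} {x : GadgetNode G κ}
    (hR : ∀ e f, x.base ∉ e → IsLift κ e f → f ∈ K.edgeSet → e ∈ R)
    {y z : GadgetNode G κ} (q : K.Walk y z) (hz : z.base = x.base) (hy : y.base ≠ x.base)
    (hq : x ∉ q.support) :
    ∃ w, G.Adj x.base w ∧ κ x.base w ≠ x.label ∧
      (SimpleGraph.fromEdgeSet R).Reachable y.base w := by
  induction q with
  | nil => exact absurd hz hy
  | @cons y y' z hadj q ih =>
    rw [SimpleGraph.Walk.support_cons, List.mem_cons, not_or] at hq
    have hadj' := hK hadj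
    -- At the first entry into the gadget of `x.base`, the entry node differs from `x`, hence so
    -- does its label. Before that, star edges project to a point and other edges to edges in `R`.
    by_cases hy' : y'.base = x.base
    · rcases hadj' with ⟨hb, -, -⟩ | ⟨h1, -, h3⟩
      · exact absurd (hb.trans hy') hy
      · rw [hy'] at h1 h3
        refine ⟨y.base, h1.symm, fun h => hq.2 ?_, SimpleGraph.Reachable.refl _⟩
        rw [GadgetNode.ext hy'.symm (h.symm.trans h3)]
        exact q.start_mem_support
    · obtain ⟨w, hw1, hw2, hw3⟩ := ih hz hy' hq.2
      refine ⟨w, hw1, hw2, ?_⟩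
      rcases hadj' with ⟨hb, -, -⟩ | ⟨h1, h2, h3⟩
      · rwa [hb]
      · refine SimpleGraph.Reachable.trans (SimpleGraph.Adj.reachable ?_) hw3
        rw [SimpleGraph.fromEdgeSet_adj]
        refine ⟨hR _ _ ?_ (isLift_of_adj h1 h2 h3) hadj, h1.ne⟩
        rw [Sym2.mem_iff, not_or]
        exact ⟨Ne.symm hy, Ne.symm hy'⟩

/-- A cycle through the edge between `x` and its hub joins the label class of `x` to another one. -/
theorem exists_merge_of_isCycle {x v : GadgetNode G κ} (hx : x ≠ hubNode κ hnb x.base)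
    {p : (gadgetGraph κ hnb).Walk v v} (hp : p.IsCycle)
    (hmem : s(x, hubNode κ hnb x.base) ∈ p.edges) {R : Set (Sym2 V)}
    (hR : ∀ e f, x.base ∉ e → IsLift κ e f → f ∈ p.edges → e ∈ R) :
    ∃ v' w, G.Adj x.base v' ∧ κ x.base v' = x.label ∧ G.Adj x.base w ∧
      κ x.base w ≠ x.label ∧ (SimpleGraph.fromEdgeSet R).Reachable v' w := by
  classical
  -- The cycle minus its edge between `x` and the hub still joins the two, and a path between them
  -- never returns to `x`.
  set K := SimpleGraph.fromEdgeSet {f | f ∈ p.edges} with hKdef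
  have hKle : K ≤ gadgetGraph κ hnb := by
    intro a b h
    exact p.edges_subset_edgeSet ((SimpleGraph.fromEdgeSet_adj _).1 h).1
  have hpK : ∀ f ∈ p.edges, f ∈ K.edgeSet := by
    intro f hf
    rw [hKdef, SimpleGraph.edgeSet_fromEdgeSet]
    exact ⟨hf, fun hd => (gadgetGraph κ hnb).not_isDiag_of_mem_edgeSet
      (p.edges_subset_edgeSet hf) hd⟩
  have hreach := (SimpleGraph.adj_and_reachable_delete_edges_iff_exists_cycle.2
    ⟨v, p.transfer K hpK, hp.transfer hpK, by rwa [SimpleGraph.Walk.edges_transfer]⟩).2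
  obtain ⟨z, hz⟩ : ∃ z, z = hubNode κ hnb x.base := ⟨_, rfl⟩
  rw [← hz] at hreach hx
  obtain ⟨q, hq⟩ := hreach.exists_isPath
  cases q with
  | nil => exact absurd rfl hx
  | @cons _ y _ hadj q =>
    rw [SimpleGraph.Walk.cons_isPath_iff] at hq
    have hadj₁ := SimpleGraph.deleteEdges_adj.1 hadj
    have hyne : y ≠ z := by
      rintro rfl
      exact hadj₁.2 rfl
    -- The only star edge at the non-hub node `x` goes to the hub and was deleted, so the path
    -- leaves along an edge from `G` to a neighbor in the class of `x`.
    rcases hKle hadj₁.1 with ⟨hb, -, h | h⟩ | ⟨h1, h2, h3⟩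
    · exact absurd (h.trans hz.symm) hx
    · rw [← hb] at h
      exact absurd (h.trans hz.symm) hyne
    · obtain ⟨w, hw1, hw2, hw3⟩ := exists_reachable_of_walk hnb
        (K := K.deleteEdges {s(x, z)})
        ((SimpleGraph.deleteEdges_le _).trans hKle) (R := R) (x := x)
        (fun e f he hl hf => hR e f he hl (by
          have := SimpleGraph.edgeSet_mono (SimpleGraph.deleteEdges_le _) hf
          rw [hKdef, SimpleGraph.edgeSet_fromEdgeSet] at this
          exact this.1)) q (by rw [hz]; rfl) h1.ne' hq.2
      exact ⟨y.base, w, h1, h2, hw1, hw2, hw3⟩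

/-- A cycle cover of the gadget graph yields, for all vertices `u` at once, edge sets avoiding `u`
that merge each non-central label class of neighbors of `u` with another class. -/
theorem exists_merging_edges [Fintype V] [DecidableEq V] [DecidableRel G.Adj] {d c : ℕ}
    (hcover : HasCycleCover (gadgetGraph κ hnb) d c) :
    ∃ R : V → Finset (Sym2 V),
      (∀ u, ∀ e ∈ R u, e ∈ G.edgeSet ∧ u ∉ e) ∧
      (∀ u, #(R u) ≤ (#((G.neighborFinset u).image (κ u)) - 1) * d) ∧
      (∀ e, #(Finset.univ.filter fun u => e ∈ R u) ≤ c * d) ∧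
      ∀ u v, G.Adj u v → κ u v ≠ κ u (nb u) → ∃ v' w, G.Adj u v' ∧ κ u v' = κ u v ∧
        G.Adj u w ∧ κ u w ≠ κ u v ∧
        (SimpleGraph.fromEdgeSet (R u : Set (Sym2 V))).Reachable v' w := by
  classical
  obtain ⟨k, v, p, hp, hd, hc⟩ := hcover
  have hS : ∀ x : GadgetNode G κ, ∃ S : Finset (Sym2 (GadgetNode G κ)),
      (x = hubNode κ hnb x.base → S = ∅) ∧ (x ≠ hubNode κ hnb x.base →
        ∃ i, S = (p i).edges.toFinset ∧ s(x, hubNode κ hnb x.base) ∈ (p i).edges) := by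
    intro x
    by_cases hx : x = hubNode κ hnb x.base
    · exact ⟨∅, fun _ => rfl, fun h => absurd hx h⟩
    · obtain ⟨⟨i, hi⟩, -⟩ := hc s(x, hubNode κ hnb x.base) (gadgetGraph_adj_hubNode hnb hx)
      exact ⟨_, fun h => absurd h hx, fun _ => ⟨i, rfl, hi⟩⟩
  choose S hS0 hS1 using hS
  have hpd : ∀ i, #(p i).edges.toFinset ≤ d := fun i =>
    (List.toFinset_card_le _).trans ((p i).length_edges.trans_le (hd i))
  have hSne : ∀ x f, f ∈ S x → x ≠ hubNode κ hnb x.base := by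
    intro x f hf h
    rw [hS0 x h] at hf
    simp at hf
  -- `R u` is the projection, without edges at `u`, of the cycles chosen for the non-hub nodes of
  -- `u`.
  refine ⟨fun u => Finset.univ.filter fun e => u ∉ e ∧ ∃ x : GadgetNode G κ, x.base = u ∧
    ∃ f ∈ S x, IsLift κ e f, ?_, ?_, ?_, ?_⟩
  · intro u e he
    obtain ⟨-, hu, x, -, f, -, hl⟩ := Finset.mem_filter.1 he
    exact ⟨hl.mem_edgeSet, hu⟩
  · intro u
    let node : V → Finset (Sym2 (GadgetNode G κ)) := fun l =>
      if h : ∃ v, G.Adj u v ∧ κ u v = l then S ⟨(u, l), h⟩ else ∅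
    have hnode : ∀ l ∈ ((G.neighborFinset u).image (κ u)).erase (κ u (nb u)),
        #((node l).image (Sym2.map base)) ≤ d := by
      intro l hl
      refine Finset.card_image_le.trans ?_
      simp only [node]
      split_ifs with h
      · by_cases hx : (⟨(u, l), h⟩ : GadgetNode G κ) = hubNode κ hnb u
        · rw [hS0 _ hx]
          simp
        · obtain ⟨i, hi, -⟩ := hS1 _ hx
          rw [hi]
          exact hpd i
      · simp
    have hmem : κ u (nb u) ∈ (G.neighborFinset u).image (κ u) :=
      Finset.mem_image_of_mem _ ((SimpleGraph.mem_neighborFinset _ _ _).2 (hnb u))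
    -- The hub has no chosen cycle, hence the `- 1`.
    rw [← Finset.card_erase_of_mem hmem]
    refine le_trans (Finset.card_le_card fun e he => ?_)
      (Finset.card_biUnion_le_card_mul _ _ d hnode)
    obtain ⟨-, hu, x, rfl, f, hf, hl⟩ := Finset.mem_filter.1 he
    refine Finset.mem_biUnion.2 ⟨x.label, Finset.mem_erase.2 ⟨fun h => ?_, ?_⟩, ?_⟩
    · exact hSne x f hf (GadgetNode.ext rfl h)
    · obtain ⟨w, hw, hxw⟩ := x.2
      exact Finset.mem_image.2 ⟨w, (SimpleGraph.mem_neighborFinset _ _ _).2 hw, hxw⟩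
    · refine Finset.mem_image.2 ⟨f, ?_, hl.map_base⟩
      have hn : node x.label = S x := dif_pos x.2
      rwa [hn]
  · intro e
    by_cases hl : ∃ f : Sym2 (GadgetNode G κ), IsLift κ e f
    · obtain ⟨f, hl⟩ := hl
      have hcount := (hc f (hl.mem_gadgetGraph hnb)).2
      let I : Finset (Fin k) := Finset.univ.filter fun i => f ∈ (p i).edges
      have hI : #I ≤ c := by
        rw [← Set.ncard_coe_finset]
        simpa [I] using hcount
      -- If `e ∈ R u`, some cycle through the unique lift of `e` also uses a star edge of `u`. Both
      -- ends of that star edge lie over `u`, so `u` is recovered from either end.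
      refine le_trans (Finset.card_le_card (t := I.biUnion fun i =>
        (p i).edges.toFinset.image fun g => (fstEnd g).base) fun u hu => ?_) ?_
      · obtain ⟨-, hu⟩ := Finset.mem_filter.1 hu
        obtain ⟨-, hu, x, rfl, f', hf', hl'⟩ := Finset.mem_filter.1 hu
        obtain rfl := hl'.unique hl
        obtain ⟨i, hi, hxi⟩ := hS1 x (hSne x f' hf')
        rw [hi, List.mem_toFinset] at hf'
        refine Finset.mem_biUnion.2 ⟨i, Finset.mem_filter.2 ⟨Finset.mem_univ _, hf'⟩,
          Finset.mem_image.2 ⟨_, List.mem_toFinset.2 hxi, ?_⟩⟩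
        rcases Sym2.eq_iff.1 (mk_fstEnd_sndEnd s(x, hubNode κ hnb x.base)) with ⟨h, -⟩ | ⟨h, -⟩
        · rw [h]
        · rw [h]
          rfl
      · exact (Finset.card_biUnion_le_card_mul _ _ d fun i _ =>
          Finset.card_image_le.trans (hpd i)).trans (Nat.mul_le_mul_right _ hI)
    · rw [Finset.filter_false_of_mem]
      · simp
      · intro u _ hu
        obtain ⟨-, -, x, -, f, -, h⟩ := Finset.mem_filter.1 hu
        exact hl ⟨f, h⟩
  · intro u v huv hne
    set x : GadgetNode G κ := ofAdj κ huv with hx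
    have hxh : x ≠ hubNode κ hnb x.base := fun h => hne (congrArg label h)
    obtain ⟨i, hi, hxi⟩ := hS1 x hxh
    refine exists_merge_of_isCycle hnb hxh (hp i) hxi fun e f he hl hf => ?_
    refine Finset.mem_coe.2 (Finset.mem_filter.2 ⟨Finset.mem_univ _, he, x, rfl, f, ?_, hl⟩)
    rw [hi]
    exact List.mem_toFinset.2 hf

end Merging

/-! ### Iterated merging -/

section Iteration

variable {V : Type*}

/-- Component representatives serve as labels, so that labels stay in `V` in every round. -/
theorem exists_component_label (H : SimpleGraph V) :
    ∃ κ : V → V, ∀ v w, κ v = κ w ↔ H.Reachable v w := by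
  refine ⟨fun v => Quot.out (H.connectedComponentMk v), fun v w => ?_⟩
  rw [← SimpleGraph.ConnectedComponent.eq]
  constructor
  · intro h
    have h1 : H.connectedComponentMk (Quot.out (H.connectedComponentMk v)) =
      H.connectedComponentMk v := Quot.out_eq _
    have h2 : H.connectedComponentMk (Quot.out (H.connectedComponentMk w)) =
      H.connectedComponentMk w := Quot.out_eq _
    exact h1.symm.trans ((congrArg H.connectedComponentMk h).trans h2)
  · intro h
    simp only [h]

variable [DecidableEq V]

/-- If each class of `κ` other than the class of `a` is merged in `κ'` with another class, then the
number of classes beyond the first one is at least halved. -/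
theorem two_mul_card_image_sub_one_le (N : Finset V) (κ κ' : V → V) {a : V} (ha : a ∈ N)
    (href : ∀ v w, κ v = κ w → κ' v = κ' w)
    (hmerge : ∀ v ∈ N, κ v ≠ κ a → ∃ w ∈ N, κ w ≠ κ v ∧ κ' w = κ' v) :
    2 * (#(N.image κ') - 1) ≤ #(N.image κ) - 1 := by
  classical
  rw [← Finset.card_erase_of_mem (Finset.mem_image_of_mem κ' ha),
    ← Finset.card_erase_of_mem (Finset.mem_image_of_mem κ ha), mul_comm]
  -- Double counting: each new class other than that of `a` contains at least two old ones, and each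
  -- old class lies in one new class.
  have := Finset.card_mul_le_card_mul (s := (N.image κ').erase (κ' a))
    (t := (N.image κ).erase (κ a)) (m := 2) (n := 1) (fun b x => ∃ v ∈ N, κ v = x ∧ κ' v = b) ?_ ?_
  · simpa using this
  · intro b hb
    obtain ⟨hne, hb⟩ := Finset.mem_erase.1 hb
    obtain ⟨v, hv, rfl⟩ := Finset.mem_image.1 hb
    have hva : κ v ≠ κ a := fun h => hne (href _ _ h)
    obtain ⟨w, hw, hwv, hw'⟩ := hmerge v hv hva
    have hwa : κ w ≠ κ a := fun h => hne (hw' ▸ href _ _ h)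
    rw [← Finset.card_pair hwv]
    refine Finset.card_le_card fun x hx => ?_
    rw [Finset.mem_bipartiteAbove]
    rcases Finset.mem_insert.1 hx with rfl | hx
    · exact ⟨Finset.mem_erase.2 ⟨hwa, Finset.mem_image_of_mem _ hw⟩, w, hw, rfl, hw'⟩
    · obtain rfl := Finset.mem_singleton.1 hx
      exact ⟨Finset.mem_erase.2 ⟨hva, Finset.mem_image_of_mem _ hv⟩, v, hv, rfl, rfl⟩
  · intro x _
    rw [Finset.card_le_one]
    intro b hb b' hb'
    obtain ⟨-, v, -, hv, rfl⟩ := (Finset.mem_bipartiteBelow _).1 hb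
    obtain ⟨-, w, -, hw, rfl⟩ := (Finset.mem_bipartiteBelow _).1 hb'
    exact href _ _ (hv.trans hw.symm)

variable [Fintype V] {G : SimpleGraph V} [DecidableRel G.Adj] {nb : V → V}
  (hnb : ∀ u, G.Adj u (nb u))

/-- After `t` rounds of merging, the number of label classes has dropped by the factor `2 ^ t`. -/
theorem exists_iterated_merging {d c : ℕ}
    (hcover : ∀ κ : V → V → V, HasCycleCover (gadgetGraph κ hnb) d c) (t : ℕ) :
    ∃ (R : V → Finset (Sym2 V)) (κ : V → V → V),
      (∀ u v w, κ u v = κ u w ↔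
        (SimpleGraph.fromEdgeSet (R u : Set (Sym2 V))).Reachable v w) ∧
      (∀ u, ∀ e ∈ R u, e ∈ G.edgeSet ∧ u ∉ e) ∧
      (∀ u, (#((G.neighborFinset u).image (κ u)) - 1) * 2 ^ t ≤ G.maxDegree) ∧
      (∀ u, #(R u) + 2 * ((#((G.neighborFinset u).image (κ u)) - 1) * d) ≤
        2 * (G.maxDegree * d)) ∧
      ∀ e, #(Finset.univ.filter fun u => e ∈ R u) ≤ t * (c * d) := by
  induction t with
  | zero =>
    choose κ hκ using fun _ : V => exists_component_label
      (SimpleGraph.fromEdgeSet ((∅ : Finset (Sym2 V)) : Set (Sym2 V)))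
    have hle : ∀ u, #((G.neighborFinset u).image (κ u)) - 1 ≤ G.maxDegree := fun u =>
      (Nat.sub_le _ _).trans (Finset.card_image_le.trans (G.degree_le_maxDegree u))
    refine ⟨fun _ => ∅, κ, hκ, by simp, by simpa using hle, fun u => ?_, by simp⟩
    have := Nat.mul_le_mul_right d (hle u)
    simp only [Finset.card_empty]
    omega
  | succ t ih =>
    obtain ⟨R, κ, hκ, hRG, hk, hR, hcong⟩ := ih
    obtain ⟨R', hR'G, hR', hcong', hmerge⟩ := exists_merging_edges hnb (hcover κ)
    choose κ' hκ' using fun u : V => exists_component_label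
      (SimpleGraph.fromEdgeSet ((R u ∪ R' u : Finset (Sym2 V)) : Set (Sym2 V)))
    have hmono : ∀ u, SimpleGraph.fromEdgeSet (R u : Set (Sym2 V)) ≤
        SimpleGraph.fromEdgeSet ((R u ∪ R' u : Finset (Sym2 V)) : Set (Sym2 V)) := fun u =>
      SimpleGraph.fromEdgeSet_mono (Finset.coe_subset.2 Finset.subset_union_left)
    have hmono' : ∀ u, SimpleGraph.fromEdgeSet (R' u : Set (Sym2 V)) ≤
        SimpleGraph.fromEdgeSet ((R u ∪ R' u : Finset (Sym2 V)) : Set (Sym2 V)) := fun u =>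
      SimpleGraph.fromEdgeSet_mono (Finset.coe_subset.2 Finset.subset_union_right)
    have href : ∀ u v w, κ u v = κ u w → κ' u v = κ' u w := fun u v w h =>
      (hκ' u v w).2 (((hκ u v w).1 h).mono (hmono u))
    have hhalf : ∀ u, 2 * (#((G.neighborFinset u).image (κ' u)) - 1) ≤
        #((G.neighborFinset u).image (κ u)) - 1 := by
      intro u
      refine two_mul_card_image_sub_one_le _ _ _
        ((SimpleGraph.mem_neighborFinset _ _ _).2 (hnb u)) (href u) fun v hv hne => ?_
      obtain ⟨v', w, -, hv', hw, hwv, hreach⟩ :=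
        hmerge u v ((SimpleGraph.mem_neighborFinset _ _ _).1 hv) hne
      refine ⟨w, (SimpleGraph.mem_neighborFinset _ _ _).2 hw, hwv, ?_⟩
      rw [← href u v' v hv', eq_comm]
      exact (hκ' u v' w).2 (hreach.mono (hmono' u))
    refine ⟨fun u => R u ∪ R' u, κ', hκ', ?_, fun u => ?_, fun u => ?_, fun e => ?_⟩
    · intro u e he
      rcases Finset.mem_union.1 he with he | he
      · exact hRG u e he
      · exact hR'G u e he
    · refine le_trans ?_ (hk u)
      rw [pow_succ', ← mul_assoc, mul_comm _ 2]
      exact Nat.mul_le_mul_right _ (hhalf u)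
    -- The potential does not grow: a round adds at most `d` edges per class beyond the first, and
    -- halving that count releases as much.
    · have h1 := Finset.card_union_le (R u) (R' u)
      have h2 := hR' u
      have h3 := hR u
      have h4 := Nat.mul_le_mul_right d (hhalf u)
      rw [mul_assoc] at h4
      change #(R u ∪ R' u) + _ ≤ _
      omega
    · simp only [Finset.mem_union, Finset.filter_or]
      refine (Finset.card_union_le _ _).trans ?_
      rw [Nat.succ_mul]
      exact Nat.add_le_add (hcong e) (hcong' e)

end Iteration

/-! ### From connecting edge sets to trees -/

section Trees

variable {V : Type*} {G : SimpleGraph V}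

/-- The subgraph of `G` given by a graph on a set of vertices. -/
def subgraphOfOn (C : Set V) (T : SimpleGraph C) (h : ∀ a b, T.Adj a b → G.Adj a b) :
    G.Subgraph where
  verts := C
  Adj a b := ∃ (ha : a ∈ C) (hb : b ∈ C), T.Adj ⟨a, ha⟩ ⟨b, hb⟩
  adj_sub := fun ⟨_, _, hab⟩ => h _ _ hab
  edge_vert := fun ⟨ha, _, _⟩ => ha
  symm := ⟨fun _ _ ⟨ha, hb, hab⟩ => ⟨hb, ha, hab.symm⟩⟩

theorem coe_subgraphOfOn (C : Set V) (T : SimpleGraph C) (h : ∀ a b, T.Adj a b → G.Adj a b) :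
    (subgraphOfOn C T h).coe = T := by
  ext a b
  exact ⟨fun ⟨_, _, hab⟩ => hab, fun hab => ⟨a.2, b.2, hab⟩⟩

/-- A longest geodesic is a path, so it has fewer edges than the tree has vertices. -/
theorem diam_le_card_edges_of_isTree {W : Type*} [Finite W] {T : SimpleGraph W} (hT : T.IsTree) :
    T.diam ≤ T.edgeSet.ncard := by
  classical
  have := Fintype.ofFinite W
  have := hT.connected.nonempty
  obtain ⟨x, y, hxy⟩ := T.exists_dist_eq_diam
  obtain ⟨p, hp, hlen⟩ := hT.connected.exists_path_of_dist x y
  have h1 := hp.length_lt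
  have h2 := hT.card_edgeFinset
  rw [← SimpleGraph.coe_edgeFinset, Set.ncard_coe_finset]
  omega

/-- A spanning tree of the component of `a` in `R` works: no edge of `R` meets `u`, so `u` is
isolated there. -/
theorem exists_tree_of_reachable [Finite V] {u a : V} (hua : G.Adj u a) (R : Finset (Sym2 V))
    (hR : ∀ e ∈ R, e ∈ G.edgeSet ∧ u ∉ e)
    (hreach : ∀ v, G.Adj u v → (SimpleGraph.fromEdgeSet (R : Set (Sym2 V))).Reachable a v) :
    ∃ T : G.Subgraph, T.coe.IsTree ∧ G.neighborSet u ⊆ T.verts ∧ u ∉ T.verts ∧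
      T.coe.diam ≤ #R ∧ ∀ e ∈ T.edgeSet, e ∈ R := by
  classical
  set H := SimpleGraph.fromEdgeSet (R : Set (Sym2 V)) with hH
  let C : Set V := (H.connectedComponentMk a).supp
  have hmem : ∀ v, v ∈ C ↔ H.Reachable v a := fun v => SimpleGraph.ConnectedComponent.eq
  have hconn : (H.induce C).Connected :=
    SimpleGraph.ConnectedComponent.connected_toSimpleGraph (H.connectedComponentMk a)
  obtain ⟨T, hTle, hT⟩ := hconn.exists_isTree_le
  have hTR : ∀ x y : C, T.Adj x y → s((x : V), (y : V)) ∈ R := by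
    intro x y hxy
    have h1 : H.Adj x y := hTle hxy
    exact ((SimpleGraph.fromEdgeSet_adj _).1 h1).1
  have hTG : ∀ x y : C, T.Adj x y → G.Adj x y := fun x y hxy => (hR _ (hTR x y hxy)).1
  refine ⟨subgraphOfOn C T hTG, ?_, ?_, ?_, ?_, ?_⟩
  · rw [coe_subgraphOfOn]
    exact hT
  · intro v hv
    exact (hmem v).2 (hreach v hv).symm
  · intro hu
    obtain ⟨p⟩ := (hmem u).1 hu
    cases p with
    | nil => exact hua.ne rfl
    | cons h _ =>
      have h1 := ((SimpleGraph.fromEdgeSet_adj _).1 h).1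
      exact (hR _ h1).2 (Sym2.mem_mk_left _ _)
  · rw [coe_subgraphOfOn]
    refine (diam_le_card_edges_of_isTree hT).trans ?_
    rw [← Set.ncard_coe_finset]
    refine Set.ncard_le_ncard_of_injOn (Sym2.map Subtype.val) ?_
      (Sym2.map.injective Subtype.val_injective).injOn R.finite_toSet
    intro e he
    induction e using Sym2.ind with
    | _ x y => exact hTR x y he
  · intro e he
    induction e using Sym2.ind with
    | _ x y =>
      obtain ⟨hx, hy, hxy⟩ := he
      exact hTR _ _ hxy

theorem IsPrivateNeighborhoodTrees.mono {T : V → G.Subgraph} {d c d' c' : ℝ}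
    (h : IsPrivateNeighborhoodTrees G T d c) (hd : d ≤ d') (hc : c ≤ c') :
    IsPrivateNeighborhoodTrees G T d' c' where
  isTree := h.isTree
  neighbors_subset := h.neighbors_subset
  avoids := h.avoids
  dilation := fun u => (h.dilation u).trans hd
  congestion := fun e he => (h.congestion e he).trans hc

theorem exists_privateNeighborhoodTrees_of_edges [Fintype V] [DecidableEq V] {nb : V → V}
    (hnb : ∀ u, G.Adj u (nb u)) {d c : ℕ} (R : V → Finset (Sym2 V))
    (hR : ∀ u, ∀ e ∈ R u, e ∈ G.edgeSet ∧ u ∉ e)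
    (hreach : ∀ u v w, G.Adj u v → G.Adj u w →
      (SimpleGraph.fromEdgeSet (R u : Set (Sym2 V))).Reachable v w)
    (hd : ∀ u, #(R u) ≤ d) (hc : ∀ e, #(Finset.univ.filter fun u => e ∈ R u) ≤ c) :
    ∃ T : V → G.Subgraph, IsPrivateNeighborhoodTrees G T d c := by
  choose T hT hN hu hdiam hTR using fun u =>
    exists_tree_of_reachable (hnb u) (R u) (hR u) fun v hv => hreach u _ v (hnb u) hv
  refine ⟨T, hT, hN, hu, fun u => by exact_mod_cast (hdiam u).trans (hd u), fun e _ => ?_⟩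
  have h1 : {u | e ∈ (T u).edgeSet}.ncard ≤ #(Finset.univ.filter fun u => e ∈ R u) := by
    rw [← Set.ncard_coe_finset]
    exact Set.ncard_le_ncard (fun u h => by simpa using hTR u e h) (Finset.finite_toSet _)
  exact_mod_cast h1.trans (hc e)

end Trees

/-! ### The main construction -/

section Main

variable {V : Type*} {G : SimpleGraph V}

theorem exists_adj_of_reachable_ne {W : Type*} {H : SimpleGraph W} {u v : W}
    (h : H.Reachable u v) (hne : u ≠ v) : ∃ w, H.Adj u w := by
  obtain ⟨p⟩ := h
  cases p with
  | nil => exact absurd rfl hne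
  | cons h _ => exact ⟨_, h⟩

theorem IsTwoVertexConnected.exists_adj (hG : IsTwoVertexConnected G) (u : V) :
    ∃ v, G.Adj u v := by
  obtain ⟨w, hw⟩ := (hG.2 u).nonempty
  exact exists_adj_of_reachable_ne (hG.1.preconnected u w) fun h => hw h.symm

theorem HasCycleCover.mono {d c d' c' : ℕ} (h : HasCycleCover G d c) (hd : d ≤ d')
    (hc : c ≤ c') : HasCycleCover G d' c' := by
  obtain ⟨k, v, p, h1, h2, h3⟩ := h
  exact ⟨k, v, p, h1, fun i => (h2 i).trans hd,
    fun e he => ⟨(h3 e he).1, (h3 e he).2.trans hc⟩⟩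

variable [Fintype V]

theorem IsTwoVertexConnected.exists_adj_ne (hG : IsTwoVertexConnected G)
    (h3 : 3 ≤ Fintype.card V) {u v : V} (huv : G.Adj u v) : ∃ w, w ≠ v ∧ G.Adj u w := by
  classical
  obtain ⟨z, -, hz⟩ := Finset.exists_mem_notMem_of_card_lt_card
    (s := ({u, v} : Finset V)) (t := Finset.univ)
    (Finset.card_le_two.trans_lt (by rw [Finset.card_univ]; omega))
  rw [Finset.mem_insert, Finset.mem_singleton, not_or] at hz
  obtain ⟨⟨w, hw⟩, h⟩ := exists_adj_of_reachable_ne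
    ((hG.2 v).preconnected ⟨u, huv.ne⟩ ⟨z, hz.2⟩) fun h => hz.1 (congrArg Subtype.val h).symm
  exact ⟨w, hw, h⟩

/-- Cycle covers of bridgeless graphs yield private neighborhood trees. -/
theorem IsTwoVertexConnected.exists_trees [DecidableRel G.Adj] (hG : IsTwoVertexConnected G)
    (h3 : 3 ≤ Fintype.card V) {d c : ℕ}
    (hcover : ∀ (N : ℕ) (H : SimpleGraph (Fin N)), IsBridgeless H →
      N ≤ 2 * G.edgeSet.ncard → H.diam ≤ 3 * G.diam + 2 → HasCycleCover H d c) :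
    ∃ T : V → G.Subgraph, IsPrivateNeighborhoodTrees G T
      ((2 * (G.maxDegree * d) : ℕ) : ℝ) (((Nat.log 2 G.maxDegree + 1) * (c * d) : ℕ) : ℝ) := by
  classical
  choose nb hnb using hG.exists_adj
  have hgadget : ∀ κ : V → V → V, HasCycleCover (gadgetGraph κ hnb) d c := by
    intro κ
    have : Finite (GadgetNode G κ) := Subtype.finite
    have := Fintype.ofFinite (GadgetNode G κ)
    have hbl : IsBridgeless (gadgetGraph κ hnb) :=
      gadgetGraph_isBridgeless hnb hG fun u v huv => hG.exists_adj_ne h3 huv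
    let f := (gadgetGraph κ hnb).overFinIso rfl
    have : Nonempty (Fin (Fintype.card (GadgetNode G κ))) := hbl.1.nonempty.map f
    refine (hcover _ _ (hbl.of_iso f) ?_ ?_).of_iso f.symm
    · rw [← Nat.card_eq_fintype_card]
      exact card_gadgetNode_le
    · exact diam_le_of_iso f (exists_gadget_walk_le_diam hnb hG.1)
  obtain ⟨R, κ, hκ, hRG, hk, hR, hcong⟩ :=
    -- With this many rounds `2 ^ t` exceeds the maximum degree, so one class remains at each
    -- vertex.
    exists_iterated_merging hnb hgadget (Nat.log 2 G.maxDegree + 1)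
  refine exists_privateNeighborhoodTrees_of_edges hnb R hRG ?_
    (fun u => (Nat.le_add_right _ _).trans (hR u)) hcong
  intro u v w hv hw
  rw [← hκ]
  have h1 := Nat.lt_pow_succ_log_self (b := 2) (by norm_num) G.maxDegree
  have h2 : #((G.neighborFinset u).image (κ u)) - 1 = 0 := by
    by_contra h
    have := Nat.mul_le_mul_right (2 ^ (Nat.log 2 G.maxDegree + 1)) (Nat.one_le_iff_ne_zero.2 h)
    have := hk u
    omega
  exact Finset.card_le_one.1 (Nat.sub_eq_zero_iff_le.1 h2) _
    (Finset.mem_image_of_mem _ ((SimpleGraph.mem_neighborFinset _ _ _).2 hv)) _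
    (Finset.mem_image_of_mem _ ((SimpleGraph.mem_neighborFinset _ _ _).2 hw))

/-- In a graph with two vertices, single vertices serve as private neighborhood trees. -/
theorem IsTwoVertexConnected.exists_trees_of_card_le_two (hG : IsTwoVertexConnected G)
    (h2 : Fintype.card V ≤ 2) : ∃ T : V → G.Subgraph, IsPrivateNeighborhoodTrees G T 0 0 := by
  classical
  choose nb hnb using hG.exists_adj
  -- Here every vertex has a single neighbor, so no edges are needed. The case is separate because
  -- the gadget graph needs degree 2 to be bridgeless, and because `log Δ = 0` forces congestion 0.
  have h := exists_privateNeighborhoodTrees_of_edges (d := 0) (c := 0) hnb (fun _ => ∅)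
    (by simp) ?_ (by simp) (by simp)
  · simpa using h
  · intro u v w hv hw
    have : v = w := by
      by_contra hne
      have h3 : #({u, v, w} : Finset V) = 3 :=
        Finset.card_eq_three.2 ⟨u, v, w, hv.ne, hw.ne, hne, rfl⟩
      have h4 := Finset.card_le_univ ({u, v, w} : Finset V)
      omega
    rw [this]

theorem IsTwoVertexConnected.two_le_maxDegree [DecidableRel G.Adj] (hG : IsTwoVertexConnected G)
    (h3 : 3 ≤ Fintype.card V) : 2 ≤ G.maxDegree := by
  classical
  obtain ⟨u⟩ := hG.1.nonempty
  obtain ⟨v, hv⟩ := hG.exists_adj u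
  obtain ⟨w, hwv, hw⟩ := hG.exists_adj_ne h3 hv
  refine le_trans ?_ (G.degree_le_maxDegree u)
  rw [← Finset.card_pair hwv, ← SimpleGraph.card_neighborFinset_eq_degree]
  refine Finset.card_le_card fun x hx => ?_
  rw [SimpleGraph.mem_neighborFinset]
  rcases Finset.mem_insert.1 hx with rfl | hx
  · exact hw
  · exact Finset.mem_singleton.1 hx ▸ hv

theorem IsTwoVertexConnected.one_le_diam (hG : IsTwoVertexConnected G)
    (h3 : 3 ≤ Fintype.card V) : 1 ≤ G.diam := by
  have : Nontrivial V := Fintype.one_lt_card_iff_nontrivial.1 (by omega)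
  exact Nat.one_le_iff_ne_zero.2 (SimpleGraph.connected_iff_diam_ne_zero.1 hG.1)

theorem two_mul_ncard_edgeSet_le (G : SimpleGraph V) :
    2 * G.edgeSet.ncard ≤ Fintype.card V ^ 2 := by
  classical
  rw [← SimpleGraph.coe_edgeFinset, Set.ncard_coe_finset, ← G.sum_degrees_eq_twice_card_edges, sq]
  refine (Finset.sum_le_card_nsmul _ _ (Fintype.card V) fun u _ =>
    (G.degree_lt_card_verts u).le).trans ?_
  simp

theorem logb_two_natCast_nonneg (n : ℕ) : 0 ≤ Real.logb 2 n :=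
  div_nonneg (Real.log_natCast_nonneg n) (Real.log_nonneg (by norm_num))

theorem one_le_logb_two_natCast {n : ℕ} (hn : 2 ≤ n) : 1 ≤ Real.logb 2 n := by
  rw [Real.le_logb_iff_rpow_le (by norm_num) (by positivity), Real.rpow_one]
  exact_mod_cast hn

theorem natLog_two_le_logb (n : ℕ) : (Nat.log 2 n : ℝ) ≤ Real.logb 2 n := by
  exact_mod_cast Real.natLog_le_logb n 2

/-- The constant 5 comes from `3D + 2 ≤ 5D` for `D ≥ 1` and is generous elsewhere; `Δ ≥ 2` absorbs
the extra round into `log Δ`. -/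
theorem IsTwoVertexConnected.exists_trees_of_cover [DecidableRel G.Adj]
    (hG : IsTwoVertexConnected G) (d c : ℕ)
    (hcover : ∀ (N : ℕ) (H : SimpleGraph (Fin N)), IsBridgeless H →
      N ≤ 5 * G.edgeSet.ncard → H.diam ≤ 5 * G.diam → HasCycleCover H d c) :
    ∃ T : V → G.Subgraph, IsPrivateNeighborhoodTrees G T
      (5 * (d * G.maxDegree)) (5 * (c * d * Real.logb 2 G.maxDegree)) := by
  rcases Nat.lt_or_ge (Fintype.card V) 3 with h2 | h3
  · obtain ⟨T, hT⟩ := hG.exists_trees_of_card_le_two (by omega)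
    have := logb_two_natCast_nonneg G.maxDegree
    exact ⟨T, hT.mono (by positivity) (by positivity)⟩
  · have hD := hG.one_le_diam h3
    obtain ⟨T, hT⟩ := hG.exists_trees h3 (d := d) (c := c) fun N H hH hN hdiam =>
      hcover N H hH (by omega) (by omega)
    refine ⟨T, hT.mono ?_ ?_⟩
    · push_cast
      have : (0 : ℝ) ≤ d * G.maxDegree := by positivity
      linarith
    · push_cast
      have h4 := natLog_two_le_logb G.maxDegree
      have h5 := one_le_logb_two_natCast (hG.two_le_maxDegree h3)
      have h6 : (0 : ℝ) ≤ c * d := by positivity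
      have h7 : (Nat.log 2 G.maxDegree + 1 : ℝ) ≤ 5 * Real.logb 2 G.maxDegree := by linarith
      calc (Nat.log 2 G.maxDegree + 1 : ℝ) * (c * d)
          ≤ 5 * Real.logb 2 G.maxDegree * (c * d) := mul_le_mul_of_nonneg_right h7 h6
        _ = 5 * (c * d * Real.logb 2 G.maxDegree) := by ring

theorem IsTwoVertexConnected.exists_trees_log [DecidableRel G.Adj]
    (hG : IsTwoVertexConnected G) :
    ∃ T : V → G.Subgraph, IsPrivateNeighborhoodTrees G T
      (200000 * (G.diam * G.maxDegree * Real.logb 2 (Fintype.card V)))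
      (200000 * (G.diam * Real.logb 2 G.maxDegree * Real.logb 2 (Fintype.card V) ^ 3)) := by
  have hΔ0 := logb_two_natCast_nonneg G.maxDegree
  have hL0 := logb_two_natCast_nonneg (Fintype.card V)
  rcases Nat.lt_or_ge (Fintype.card V) 3 with h2 | h3
  · obtain ⟨T, hT⟩ := hG.exists_trees_of_card_le_two (by omega)
    exact ⟨T, hT.mono (by positivity) (by positivity)⟩
  · set n := Fintype.card V with hn
    set q := Nat.log 2 (n ^ 4) with hq
    obtain ⟨T, hT⟩ := hG.exists_trees h3 (d := (2 * q + 3) * (6 * G.diam + 5))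
      (c := (q + 1) * (32 * q + 17)) fun N H hH hN hdiam => by
        -- The gadget graph has at most `2m ≤ n ^ 2` nodes, hence at most `n ^ 4` edges, so `q ≤ 4
        -- log n`.
        have h1 : H.edgeSet.ncard ≤ n ^ 4 := by
          have h4 := two_mul_ncard_edgeSet_le H
          have h5 := two_mul_ncard_edgeSet_le G
          rw [Fintype.card_fin] at h4
          have h6 : N ^ 2 ≤ (n ^ 2) ^ 2 := Nat.pow_le_pow_left (hN.trans h5) 2
          have h7 : (n ^ 2) ^ 2 = n ^ 4 := by rw [← pow_mul]
          omega
        refine (hH.hasCycleCover (q := q) (Nat.log_mono_right h1)).mono ?_ le_rfl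
        exact Nat.mul_le_mul_left _ (by omega)
    have hD : (1 : ℝ) ≤ G.diam := by exact_mod_cast hG.one_le_diam h3
    set D : ℝ := (G.diam : ℝ) with hDdef
    set L := Real.logb 2 n with hL
    set ℓ := Real.logb 2 G.maxDegree with hℓ
    have hL1 : 1 ≤ L := one_le_logb_two_natCast (by omega)
    have hℓ1 : 1 ≤ ℓ := one_le_logb_two_natCast (hG.two_le_maxDegree h3)
    have hqL : (q : ℝ) ≤ 4 * L := by
      refine (natLog_two_le_logb _).trans ?_
      rw [Nat.cast_pow, Real.logb_pow, ← hL]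
      norm_num
    have hq0 : (0 : ℝ) ≤ q := Nat.cast_nonneg q
    have hd : ((2 * q + 3) * (6 * D + 5) : ℝ) ≤ 11 * L * (11 * D) :=
      mul_le_mul (by linarith) (by linarith) (by linarith) (by linarith)
    have hc : ((q + 1) * (32 * q + 17) : ℝ) ≤ 5 * L * (145 * L) :=
      mul_le_mul (by linarith) (by linarith) (by linarith) (by linarith)
    have hlog : (Nat.log 2 G.maxDegree + 1 : ℝ) ≤ 2 * ℓ := by
      have := natLog_two_le_logb G.maxDegree
      linarith
    refine ⟨T, hT.mono ?_ ?_⟩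
    · push_cast
      have h0 : (0 : ℝ) ≤ G.maxDegree := Nat.cast_nonneg _
      have h1 : 0 ≤ D * G.maxDegree * L := by positivity
      calc (2 * (G.maxDegree * ((2 * q + 3) * (6 * D + 5))) : ℝ)
          ≤ 2 * (G.maxDegree * (11 * L * (11 * D))) := by gcongr
        _ = 242 * (D * G.maxDegree * L) := by ring
        _ ≤ 200000 * (D * G.maxDegree * L) := by linarith
    · push_cast
      have h1 : 0 ≤ D * ℓ * L ^ 3 := by positivity
      calc ((Nat.log 2 G.maxDegree + 1) *
            ((q + 1) * (32 * q + 17) * ((2 * q + 3) * (6 * D + 5))) : ℝ)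
          ≤ 2 * ℓ * (5 * L * (145 * L) * (11 * L * (11 * D))) := by gcongr
        _ = 175450 * (D * ℓ * L ^ 3) := by ring
        _ ≤ 200000 * (D * ℓ * L ^ 3) := by linarith

end Main

end PrivateTrees

theorem theorem2 :
    (∃ K : ℕ, ∀ (V : Type*) [Fintype V] (G : SimpleGraph V) [DecidableRel G.Adj],
      PrivateTrees.IsTwoVertexConnected G →
      ∃ T : V → G.Subgraph, PrivateTrees.IsPrivateNeighborhoodTrees G T
        (K * (G.diam * G.maxDegree * Real.logb 2 (Fintype.card V)))
        (K * (G.diam * Real.logb 2 G.maxDegree * Real.logb 2 (Fintype.card V) ^ 3))) ∧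
    (∃ K : ℕ, ∀ (V : Type*) [Fintype V] (G : SimpleGraph V) [DecidableRel G.Adj],
      PrivateTrees.IsTwoVertexConnected G →
      ∀ d c : ℕ,
      (∀ (N : ℕ) (H : SimpleGraph (Fin N)), PrivateTrees.IsBridgeless H →
        N ≤ K * G.edgeSet.ncard → H.diam ≤ K * G.diam → PrivateTrees.HasCycleCover H d c) →
      ∃ T : V → G.Subgraph, PrivateTrees.IsPrivateNeighborhoodTrees G T
        (K * (d * G.maxDegree))
        (K * (c * d * Real.logb 2 G.maxDegree))) := by
  refine ⟨⟨200000, fun V _ G _ hG => ?_⟩, ⟨5, fun V _ G _ hG d c hcover => ?_⟩⟩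
  · exact_mod_cast hG.exists_trees_log
  · exact_mod_cast hG.exists_trees_of_cover d c hcover
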